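/- Let $\Omega\subset\mathbb C$ be a simply connected domain, let $\mathbb D$ be the open unit disc, and let $A:\Omega\to\mathbb R^{2\times2}$ be a measurable symmetric matrix function with $\det A=1$ a.e. in $\Omega$ which is uniformly elliptic: for some $1\le K'<\infty$, $\frac1{K'}|\xi|^2\le\langle A(z)\xi,\xi\rangle\le K'|\xi|^2$ for almost all $z\in\Omega$ and all $\xi\in\mathbb R^2$. Put $$\mu(z)=\frac{a_{22}(z)-a_{11}(z)-2i\,a_{12}(z)}{\det(I+A(z))},\qquad K=\frac{1+\|\mu\mid L^\infty(\Omega)\|}{1-\|\mu\mid L^\infty(\Omega)\|}.$$ An $A$-quasiconformal mapping $\varphi:\Omega\to\mathbb D$ is a homeomorphism of $\Omega$ onto $\mathbb D$ of class $W^{1,2}_{loc}(\Omega)$ such that $|D\varphi|^2\le K''|J(\cdot,\varphi)|$ a.e. in $\Omega$ for some $1\le K''<\infty$ and $\varphi_{\bar z}=\mu\,\varphi_z$ a.e. in $\Omega$. (All derivatives and Jacobians are weak ones.) Suppose that $\Omega$ is a volume-preserving $A$-quasiconformal $\beta$-regular domain for some $1<\beta<\infty$, i.e. there is an $A$-quasiconformal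 mapping $\varphi:\Omega\to\mathbb D$ with $\iint_{\mathbb D}|J(w,\varphi^{-1})|^\beta\,du\,dv<\infty$ and $|J(z,\varphi)|=1$ for almost all $z\in\Omega$. Then $$\lambda_1(A,\Omega)\le K\,\lambda_1(\mathbb D).$$ Here $W^{1,2}_0(\Omega,A)$ is the closure of $C_0^\infty(\Omega)$ in the space of real locally integrable, weakly differentiable functions on $\Omega$ with finite norm $\left(\iint_\Omega|f|^2\,dx\,dy\right)^{1/2}+\left(\iint_\Omega\langle A\nabla f,\nabla f\rangle\,dx\,dy\right)^{1/2}$, and $\lambda_1(A,\Omega)$ is the first Dirichlet eigenvalue of $-\mathrm{div}[A\nabla f]$ in $\Omega$, $$\lambda_1(A,\Omega)=\inf_{f\in W_0^{1,2}(\Omega,A)\setminus\{0\}}\frac{\iint_\Omega\langle A\nabla f,\nabla f\rangle\,dx\,dy}{\iint_\Omega|f|^2\,dx\,dy},\qquad \lambda_1(\mathbb D)=\lambda_1(I,\mathbb D).$$ The inequality also holds when $\lambda_1(A,\Omega)$ and $\lambda_1(\mathbb D)$ are read as the least weak Dirichlet eigenvalues, where $l\in\mathbb R$ is a weak Dirichlet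 eigenvalue of $A$ in $\Omega$ if some $f\in W^{1,2}_0(\Omega,A)\setminus\{0\}$ satisfies $\iint_\Omega\langle A\nabla f,\nabla g\rangle\,dx\,dy=l\iint_\Omega fg\,dx\,dy$ for all $g\in W^{1,2}_0(\Omega,A)$. -/

import Mathlib

open MeasureTheory Set
open scoped ENNReal ContDiff Matrix

noncomputable section

namespace AQuasiconformal

section Sobolev

variable {F : Type*} [NormedAddCommGroup F] [NormedSpace ℝ F]

/-- The space `C₀^∞(Ω)` of real test functions: smooth, with compact support contained in `Ω`. -/
def IsTestFunction (Ω : Set ℂ) (η : ℂ → ℝ) : Prop :=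
  ContDiff ℝ ∞ η ∧ HasCompactSupport η ∧ tsupport η ⊆ Ω

/-- The locally integrable function `f` has the locally integrable weak (distributional)
derivative `Df` on `Ω`; the derivative is recorded as an `ℝ`-linear map at each point. -/
structure HasWeakFDerivOn (Ω : Set ℂ) (f : ℂ → F) (Df : ℂ → ℂ →L[ℝ] F) : Prop where
  locInt : LocallyIntegrableOn f Ω
  locInt_deriv : LocallyIntegrableOn Df Ω
  integral_eq : ∀ η : ℂ → ℝ, IsTestFunction Ω η → ∀ v : ℂ,
    ∫ z in Ω, (fderiv ℝ η z v) • f z = - ∫ z in Ω, η z • Df z v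

/-- `f` is locally integrable and weakly differentiable on `Ω`. -/
def WeaklyDifferentiableOn (Ω : Set ℂ) (f : ℂ → F) : Prop :=
  ∃ Df : ℂ → ℂ →L[ℝ] F, HasWeakFDerivOn Ω f Df

open Classical in
/-- The weak derivative of `f` on the open set `Ω`, well defined up to a null set
(and `0` if `f` is not weakly differentiable). -/
def weakFDeriv (Ω : Set ℂ) (f : ℂ → F) : ℂ → ℂ →L[ℝ] F :=
  if h : WeaklyDifferentiableOn Ω f then h.choose else 0

end Sobolev

/-- The weak gradient `∇f = (∂f/∂x, ∂f/∂y)` of a real function on `Ω`. -/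
def weakGrad (Ω : Set ℂ) (f : ℂ → ℝ) (z : ℂ) : Fin 2 → ℝ :=
  ![weakFDeriv Ω f z 1, weakFDeriv Ω f z Complex.I]

/-- The square of the seminorm of `L^{1,2}(Ω, A)`: `∬_Ω ⟨A ∇f, ∇f⟩ dx dy`, in `[0, ∞]`. -/
def energy (A : ℂ → Matrix (Fin 2) (Fin 2) ℝ) (Ω : Set ℂ) (f : ℂ → ℝ) : ℝ≥0∞ :=
  ∫⁻ z in Ω, ENNReal.ofReal ((A z *ᵥ weakGrad Ω f z) ⬝ᵥ weakGrad Ω f z)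

/-- The norm `‖f | L²(Ω)‖ + ‖f | L^{1,2}(Ω, A)‖` of `W^{1,2}(Ω, A)`, in `[0, ∞]`. -/
def sobolevNorm (A : ℂ → Matrix (Fin 2) (Fin 2) ℝ) (Ω : Set ℂ) (f : ℂ → ℝ) : ℝ≥0∞ :=
  eLpNorm f 2 (volume.restrict Ω) + (energy A Ω f) ^ (1 / 2 : ℝ)

/-- Membership in the Sobolev space `W^{1,2}(Ω, A)`. -/
def MemSobolev (A : ℂ → Matrix (Fin 2) (Fin 2) ℝ) (Ω : Set ℂ) (f : ℂ → ℝ) : Prop :=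
  WeaklyDifferentiableOn Ω f ∧ sobolevNorm A Ω f < ⊤

/-- Membership in `W₀^{1,2}(Ω, A)`, the closure of `C₀^∞(Ω)` in the norm of `W^{1,2}(Ω, A)`. -/
def MemSobolevZero (A : ℂ → Matrix (Fin 2) (Fin 2) ℝ) (Ω : Set ℂ) (f : ℂ → ℝ) : Prop :=
  MemSobolev A Ω f ∧
    ∀ ε : ℝ≥0∞, 0 < ε → ∃ η : ℂ → ℝ, IsTestFunction Ω η ∧ sobolevNorm A Ω (f - η) < ε

/-- `f` is a nonzero element of `W₀^{1,2}(Ω, A)` (functions being identified almost everywhere). -/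
def MemSobolevZeroNonzero (A : ℂ → Matrix (Fin 2) (Fin 2) ℝ) (Ω : Set ℂ) (f : ℂ → ℝ) : Prop :=
  MemSobolevZero A Ω f ∧ ¬ f =ᵐ[volume.restrict Ω] 0

/-- The first Dirichlet eigenvalue `λ₁(A, Ω)` of `-div[A ∇f]` in its variational form: the infimum
of the Rayleigh quotients over `W₀^{1,2}(Ω, A) \ {0}`. -/
def firstEigenvalue (A : ℂ → Matrix (Fin 2) (Fin 2) ℝ) (Ω : Set ℂ) : ℝ :=
  sInf {r : ℝ | ∃ f : ℂ → ℝ, MemSobolevZeroNonzero A Ω f ∧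
    r = (energy A Ω f).toReal / ∫ z in Ω, f z ^ 2}

/-- The set of Dirichlet eigenvalues of `-div[A ∇f]` in `Ω`, in the weak sense: those `l` for which
there is a nonzero `f ∈ W₀^{1,2}(Ω, A)` such that `∬_Ω ⟨A ∇f, ∇g⟩ = l ∬_Ω f g` for all
`g ∈ W₀^{1,2}(Ω, A)`. -/
def dirichletEigenvalues (A : ℂ → Matrix (Fin 2) (Fin 2) ℝ) (Ω : Set ℂ) : Set ℝ :=
  {l : ℝ | ∃ f : ℂ → ℝ, MemSobolevZeroNonzero A Ω f ∧
    ∀ g : ℂ → ℝ, MemSobolevZero A Ω g →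
      ∫ z in Ω, (A z *ᵥ weakGrad Ω f z) ⬝ᵥ weakGrad Ω g z = l * ∫ z in Ω, f z * g z}

/-- The uniform ellipticity condition with constant `K`. -/
def IsElliptic (K : ℝ) (A : ℂ → Matrix (Fin 2) (Fin 2) ℝ) (Ω : Set ℂ) : Prop :=
  ∀ᵐ z ∂(volume.restrict Ω), ∀ ξ : Fin 2 → ℝ,
    1 / K * (ξ ⬝ᵥ ξ) ≤ (A z *ᵥ ξ) ⬝ᵥ ξ ∧ (A z *ᵥ ξ) ⬝ᵥ ξ ≤ K * (ξ ⬝ᵥ ξ)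

/-- The class `M^{2×2}(Ω)`: measurable symmetric matrix functions with `det A = 1` a.e. which
are uniformly elliptic for some `1 ≤ K < ∞`. -/
structure MatrixClass (A : ℂ → Matrix (Fin 2) (Fin 2) ℝ) (Ω : Set ℂ) : Prop where
  measurable : ∀ i j, AEMeasurable (fun z => A z i j) (volume.restrict Ω)
  symm : ∀ᵐ z ∂(volume.restrict Ω), (A z).IsSymm
  det_eq_one : ∀ᵐ z ∂(volume.restrict Ω), (A z).det = 1
  elliptic : ∃ K : ℝ, 1 ≤ K ∧ IsElliptic K A Ω

/-- The complex dilatation `μ = (a₂₂ - a₁₁ - 2 i a₁₂) / det(I + A)` induced by `A`. -/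
def complexDilatation (A : ℂ → Matrix (Fin 2) (Fin 2) ℝ) (z : ℂ) : ℂ :=
  (((A z 1 1 - A z 0 0 : ℝ) : ℂ) - 2 * Complex.I * ((A z 0 1 : ℝ) : ℂ)) /
    (((1 + A z).det : ℝ) : ℂ)

/-- The quasiconformality coefficient `K = (1 + ‖μ | L^∞(Ω)‖) / (1 - ‖μ | L^∞(Ω)‖)`. -/
def qcCoefficient (A : ℂ → Matrix (Fin 2) (Fin 2) ℝ) (Ω : Set ℂ) : ℝ :=
  (1 + (eLpNorm (complexDilatation A) ∞ (volume.restrict Ω)).toReal) /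
    (1 - (eLpNorm (complexDilatation A) ∞ (volume.restrict Ω)).toReal)

/-- The (weak) Jacobian `J(z, φ)` of a planar map on `Ω`. -/
def jacobian (Ω : Set ℂ) (φ : ℂ → ℂ) (z : ℂ) : ℝ :=
  (weakFDeriv Ω φ z).det

/-- The weak Wirtinger derivative `φ_z = (φ_x - i φ_y) / 2`. -/
def dz (Ω : Set ℂ) (φ : ℂ → ℂ) (z : ℂ) : ℂ :=
  1 / 2 * (weakFDeriv Ω φ z 1 - Complex.I * weakFDeriv Ω φ z Complex.I)

/-- The weak Wirtinger derivative `φ_{z̄} = (φ_x + i φ_y) / 2`. -/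
def dzbar (Ω : Set ℂ) (φ : ℂ → ℂ) (z : ℂ) : ℂ :=
  1 / 2 * (weakFDeriv Ω φ z 1 + Complex.I * weakFDeriv Ω φ z Complex.I)

/-- `φ` is a `K`-quasiconformal mapping of `Ω` onto `Ω'`: a homeomorphism of class
`W^{1,2}_loc(Ω)` with `|Dφ|² ≤ K |J(·, φ)|` a.e. in `Ω`, where `|Dφ|` is the operator norm. -/
structure IsQuasiconformal (K : ℝ) (Ω Ω' : Set ℂ) (φ : OpenPartialHomeomorph ℂ ℂ) : Prop where
  source_eq : φ.source = Ω
  target_eq : φ.target = Ω'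
  one_le : 1 ≤ K
  weaklyDiff : WeaklyDifferentiableOn Ω φ
  locInt_sq : LocallyIntegrableOn (fun z => ‖weakFDeriv Ω φ z‖ ^ 2) Ω
  distortion : ∀ᵐ z ∂(volume.restrict Ω), ‖weakFDeriv Ω φ z‖ ^ 2 ≤ K * |jacobian Ω φ z|

/-- `φ` is an `A`-quasiconformal mapping of `Ω` onto `Ω'`: a quasiconformal mapping that satisfies
the Beltrami equation `φ_{z̄} = μ φ_z` a.e. in `Ω` with the complex dilatation `μ` of `A`. -/
def IsAQuasiconformal (A : ℂ → Matrix (Fin 2) (Fin 2) ℝ) (Ω Ω' : Set ℂ)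
    (φ : OpenPartialHomeomorph ℂ ℂ) : Prop :=
  (∃ K : ℝ, IsQuasiconformal K Ω Ω' φ) ∧
    ∀ᵐ z ∂(volume.restrict Ω), dzbar Ω φ z = complexDilatation A z * dz Ω φ z

/-- `Ω` is a simply connected domain in the plane. -/
def IsSimplyConnectedDomain (Ω : Set ℂ) : Prop :=
  IsOpen Ω ∧ IsConnected Ω ∧ IsSimplyConnected Ω

/-- The simply connected domain `Ω` is `A`-quasiconformal `β`-regular about the simply connected
domain `Ω'`, with corresponding `A`-quasiconformal mapping `φ : Ω → Ω'`:
`∬_{Ω'} |J(w, φ⁻¹)|^β du dv < ∞`. -/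
structure IsRegularDomain (A : ℂ → Matrix (Fin 2) (Fin 2) ℝ) (β : ℝ) (Ω Ω' : Set ℂ)
    (φ : OpenPartialHomeomorph ℂ ℂ) : Prop where
  domain : IsSimplyConnectedDomain Ω
  domain' : IsSimplyConnectedDomain Ω'
  one_lt : 1 < β
  map : IsAQuasiconformal A Ω Ω' φ
  integrable : ∫⁻ w in Ω', ENNReal.ofReal (|jacobian Ω' φ.symm w| ^ β) < ⊤

/-- The open unit disc. -/
def unitDisc : Set ℂ := Metric.ball 0 1

/-- `Ω` is a volume-preserving `A`-quasiconformal `β`-regular domain: it is `A`-quasiconformal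
`β`-regular about the unit disc, with an `A`-quasiconformal mapping `φ : Ω → 𝔻` such that
`|J(z, φ)| = 1` a.e. in `Ω`. -/
def IsVolumePreservingRegularDomain (A : ℂ → Matrix (Fin 2) (Fin 2) ℝ) (β : ℝ)
    (Ω : Set ℂ) : Prop :=
  ∃ φ : OpenPartialHomeomorph ℂ ℂ, IsRegularDomain A β Ω unitDisc φ ∧
    ∀ᵐ z ∂(volume.restrict Ω), |jacobian Ω φ z| = 1

end AQuasiconformal

end

/-! The inequality is a weakened equality. Composition with a volume-preserving $A$-quasiconformal
map $\varphi$ identifies the Dirichlet problem for $A$ on $\Omega$ with that for the Laplacian on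
the disc, so the first eigenvalues, and even the whole sets of weak eigenvalues, coincide. The
factor $K$ enters only at the end, through $K\ge1$ and the nonnegativity of the eigenvalues.

The Beltrami equation with $|\mu|\le1$ forces $J\ge0$, so $|J|=1$ means $J=1$, and the distortion
inequality then bounds $D\varphi$ (`isFormPreserving_of_volumePreserving`). A continuous map with
bounded weak derivative is locally Lipschitz, hence differentiable a.e. and subject to Lusin's
property (N). The area formula then shows that $f\mapsto f\circ\varphi$ preserves integrals
(`IsUnimodular.lintegral_comp`). Pointwise, the Beltrami equation with $J=1$ says
$D\varphi\,A\,D\varphi^T=I$, so this map carries the Euclidean form of gradients to the form of $A$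
(`gradForm_comp_eq`).

The converse inclusions need the same facts for $\varphi^{-1}$. Its weak derivative is the adjugate
of $D\varphi$ transported to the target (`IsUnimodular.symm`), because the columns of the adjugate
are weakly divergence free. That composition preserves $W^{1,2}_0$ is
`IsUnimodular.isSobolevZero_comp`: $\eta\circ\varphi$ is only Lipschitz for a test function $\eta$,
and mollification turns it back into a test function. -/

noncomputable section

namespace AQuasiconformal

open Filter Topology Metric
open scoped Convolution NNReal

/-! ### Calculus of weak derivatives: uniqueness, restriction, $L^2$-limits. -/

section WeakDerivative

variable {F : Type*} [NormedAddCommGroup F] [NormedSpace ℝ F]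

lemma IsTestFunction.mono {U Ω : Set ℂ} {η : ℂ → ℝ} (h : IsTestFunction U η) (hU : U ⊆ Ω) :
    IsTestFunction Ω η := ⟨h.1, h.2.1, h.2.2.trans hU⟩

lemma IsTestFunction.continuous {Ω : Set ℂ} {η : ℂ → ℝ} (h : IsTestFunction Ω η) :
    Continuous η := h.1.continuous

lemma IsTestFunction.differentiable {Ω : Set ℂ} {η : ℂ → ℝ} (h : IsTestFunction Ω η) :
    Differentiable ℝ η := h.1.differentiable (by simp)

lemma IsTestFunction.fderiv_apply {Ω : Set ℂ} {η : ℂ → ℝ} (h : IsTestFunction Ω η) (v : ℂ) :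
    IsTestFunction Ω (fun z => fderiv ℝ η z v) := by
  refine ⟨(h.1.fderiv_right (m := ∞) (by simp)).clm_apply contDiff_const, ?_, ?_⟩
  · exact h.2.1.fderiv_apply (𝕜 := ℝ) v
  · exact (tsupport_fderiv_apply_subset ℝ v).trans h.2.2

lemma setIntegral_smul_eq_integral {Ω : Set ℂ} {η : ℂ → ℝ} (h : tsupport η ⊆ Ω) (f : ℂ → F) :
    ∫ z in Ω, η z • f z = ∫ z, η z • f z :=
  setIntegral_eq_integral_of_forall_compl_eq_zero fun z hz => by
    rw [image_eq_zero_of_notMem_tsupport fun hz' => hz (h hz'), zero_smul]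

lemma setIntegral_fderiv_smul_eq_integral {Ω : Set ℂ} {η : ℂ → ℝ} (h : tsupport η ⊆ Ω) (v : ℂ)
    (f : ℂ → F) : ∫ z in Ω, (fderiv ℝ η z v) • f z = ∫ z, (fderiv ℝ η z v) • f z :=
  setIntegral_smul_eq_integral ((tsupport_fderiv_apply_subset ℝ v).trans h) f

lemma integrable_smul_of_locallyIntegrableOn {Ω : Set ℂ} {η : ℂ → ℝ} (hη : Continuous η)
    (hc : HasCompactSupport η) (hs : tsupport η ⊆ Ω) {f : ℂ → F} (hf : LocallyIntegrableOn f Ω) :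
    Integrable (fun z => η z • f z) := by
  have h1 : IntegrableOn f (tsupport η) := hf.integrableOn_compact_subset hs hc
  have h2 : IntegrableOn (fun z => η z • f z) (tsupport η) :=
    h1.continuousOn_smul hη.continuousOn hc
  refine (integrableOn_iff_integrable_of_support_subset ?_).1 h2
  intro z hz
  apply subset_tsupport
  intro h0
  exact hz (by simp [h0])

lemma IsTestFunction.integrable_smul {Ω : Set ℂ} {η : ℂ → ℝ} (h : IsTestFunction Ω η) {f : ℂ → F}
    (hf : LocallyIntegrableOn f Ω) : Integrable (fun z => η z • f z) :=
  integrable_smul_of_locallyIntegrableOn h.continuous h.2.1 h.2.2 hf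

lemma _root_.MeasureTheory.LocallyIntegrableOn.clm_apply_const {Ω : Set ℂ} {D : ℂ → ℂ →L[ℝ] F}
    (h : LocallyIntegrableOn D Ω) (v : ℂ) : LocallyIntegrableOn (fun z => D z v) Ω := by
  intro z hz
  obtain ⟨s, hs, hi⟩ := h z hz
  exact ⟨s, hs, (ContinuousLinearMap.apply ℝ F v).integrable_comp hi⟩

lemma clm_ext_one_I {D D' : ℂ →L[ℝ] F} (h1 : D 1 = D' 1) (hI : D Complex.I = D' Complex.I) :
    D = D' := by
  ext z
  have hz : z = z.re • (1 : ℂ) + z.im • Complex.I := by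
    simp [Complex.real_smul, Complex.re_add_im]
  rw [hz]
  simp only [map_add, map_smul, h1, hI]

lemma _root_.MeasureTheory.LocallyIntegrableOn.congr_ae {Ω : Set ℂ}
    {E : Type*} [NormedAddCommGroup E] {f g : ℂ → E}
    (h : LocallyIntegrableOn f Ω) (hfg : f =ᵐ[volume.restrict Ω] g) : LocallyIntegrableOn g Ω := by
  intro z hz
  obtain ⟨s, hs, hi⟩ := h z hz
  refine ⟨s ∩ Ω, inter_mem hs self_mem_nhdsWithin, ?_⟩
  have hi' : IntegrableOn f (s ∩ Ω) := hi.mono_set inter_subset_left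
  exact hi'.congr (ae_restrict_of_ae_restrict_of_subset inter_subset_right hfg)

/-- By the fundamental lemma of the calculus of variations in each fixed direction; the directions
$1$ and $i$ determine a real-linear map. -/
lemma HasWeakFDerivOn.ae_eq [CompleteSpace F] {Ω : Set ℂ} (hΩ : IsOpen Ω) {f : ℂ → F}
    {D D' : ℂ → ℂ →L[ℝ] F}
    (h : HasWeakFDerivOn Ω f D) (h' : HasWeakFDerivOn Ω f D') : D =ᵐ[volume.restrict Ω] D' := by
  have key : ∀ v : ℂ, ∀ᵐ z ∂(volume : Measure ℂ), z ∈ Ω → D z v - D' z v = 0 := by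
    intro v
    have hD := h.locInt_deriv.clm_apply_const v
    have hD' := h'.locInt_deriv.clm_apply_const v
    refine hΩ.ae_eq_zero_of_integral_contDiff_smul_eq_zero (hD.sub hD') ?_
    intro η h1 h2 h3
    have hη : IsTestFunction Ω η := ⟨h1, h2, h3⟩
    have e1 := h.integral_eq η hη v
    have e2 := h'.integral_eq η hη v
    rw [setIntegral_smul_eq_integral h3] at e1 e2
    have : ∫ z, η z • (D z v - D' z v) = (∫ z, η z • D z v) - ∫ z, η z • D' z v := by
      rw [← integral_sub (hη.integrable_smul hD) (hη.integrable_smul hD')]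
      simp only [smul_sub]
    rw [this, sub_eq_zero, ← neg_inj, ← e1, ← e2]
  filter_upwards [(ae_restrict_iff' hΩ.measurableSet).2 (key 1),
    (ae_restrict_iff' hΩ.measurableSet).2 (key Complex.I)] with z h1 h2
  exact clm_ext_one_I (sub_eq_zero.1 h1) (sub_eq_zero.1 h2)

lemma WeaklyDifferentiableOn.hasWeakFDerivOn {Ω : Set ℂ} {f : ℂ → F}
    (h : WeaklyDifferentiableOn Ω f) : HasWeakFDerivOn Ω f (weakFDeriv Ω f) := by
  rw [weakFDeriv, dif_pos h]
  exact h.choose_spec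

lemma HasWeakFDerivOn.weakFDeriv_ae_eq [CompleteSpace F] {Ω : Set ℂ} (hΩ : IsOpen Ω) {f : ℂ → F}
    {D : ℂ → ℂ →L[ℝ] F} (h : HasWeakFDerivOn Ω f D) :
    weakFDeriv Ω f =ᵐ[volume.restrict Ω] D :=
  (WeaklyDifferentiableOn.hasWeakFDerivOn ⟨D, h⟩).ae_eq hΩ h

lemma HasWeakFDerivOn.congr {Ω : Set ℂ} {f g : ℂ → F} {D D' : ℂ → ℂ →L[ℝ] F}
    (h : HasWeakFDerivOn Ω f D) (hf : f =ᵐ[volume.restrict Ω] g)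
    (hD : D =ᵐ[volume.restrict Ω] D') : HasWeakFDerivOn Ω g D' where
  locInt := h.locInt.congr_ae hf
  locInt_deriv := h.locInt_deriv.congr_ae hD
  integral_eq η hη v := by
    rw [← integral_congr_ae (hf.mono fun z hz => by simp only [hz] :
        (fun z => (fderiv ℝ η z v) • f z) =ᵐ[volume.restrict Ω] fun z => (fderiv ℝ η z v) • g z),
      ← integral_congr_ae (hD.mono fun z hz => by simp only [hz] :
        (fun z => η z • D z v) =ᵐ[volume.restrict Ω] fun z => η z • D' z v)]
    exact h.integral_eq η hη v

lemma HasWeakFDerivOn.mono {U Ω : Set ℂ} {f : ℂ → F} {D : ℂ → ℂ →L[ℝ] F}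
    (h : HasWeakFDerivOn Ω f D) (hU : U ⊆ Ω) : HasWeakFDerivOn U f D where
  locInt := h.locInt.mono_set hU
  locInt_deriv := h.locInt_deriv.mono_set hU
  integral_eq η hη v := by
    have := h.integral_eq η (hη.mono hU) v
    rwa [setIntegral_fderiv_smul_eq_integral (hη.2.2.trans hU),
      setIntegral_smul_eq_integral (hη.2.2.trans hU), ← setIntegral_fderiv_smul_eq_integral hη.2.2,
      ← setIntegral_smul_eq_integral hη.2.2] at this

lemma HasWeakFDerivOn.sub {Ω : Set ℂ} {f g : ℂ → F} {D D' : ℂ → ℂ →L[ℝ] F}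
    (hf : HasWeakFDerivOn Ω f D) (hg : HasWeakFDerivOn Ω g D') :
    HasWeakFDerivOn Ω (f - g) (D - D') where
  locInt := hf.locInt.sub hg.locInt
  locInt_deriv := hf.locInt_deriv.sub hg.locInt_deriv
  integral_eq η hη v := by
    have e1 := hf.integral_eq η hη v
    have e2 := hg.integral_eq η hη v
    have i1 := ((hη.fderiv_apply v).integrable_smul hf.locInt).integrableOn (s := Ω)
    have i2 := ((hη.fderiv_apply v).integrable_smul hg.locInt).integrableOn (s := Ω)
    have i3 := (hη.integrable_smul (hf.locInt_deriv.clm_apply_const v)).integrableOn (s := Ω)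
    have i4 := (hη.integrable_smul (hg.locInt_deriv.clm_apply_const v)).integrableOn (s := Ω)
    simp only [Pi.sub_apply, smul_sub, sub_apply]
    rw [integral_sub i1 i2, integral_sub i3 i4, e1, e2]
    abel

/-- The integral against a bounded test function is continuous with respect to `L²`-convergence. -/
lemma tendsto_setIntegral_smul_of_eLpNorm {Ω : Set ℂ} {η : ℂ → ℝ} (hη : Continuous η)
    (hc : HasCompactSupport η) {f : ℕ → ℂ → F} {g : ℂ → F}
    (hf : ∀ n, MemLp (f n) 2 (volume.restrict Ω)) (hg : MemLp g 2 (volume.restrict Ω))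
    (h : Tendsto (fun n => eLpNorm (f n - g) 2 (volume.restrict Ω)) atTop (𝓝 0)) :
    Tendsto (fun n => ∫ z in Ω, η z • f n z) atTop (𝓝 (∫ z in Ω, η z • g z)) := by
  have hη2 : MemLp η 2 (volume.restrict Ω) :=
    (hη.memLp_of_hasCompactSupport hc).mono_measure Measure.restrict_le_self
  refine tendsto_integral_of_L1' (fun z => η z • g z) ?_ ?_ ?_
  · exact (memLp_one_iff_integrable.1 (hg.smul hη2)).aestronglyMeasurable
  · exact Eventually.of_forall fun n => memLp_one_iff_integrable.1 ((hf n).smul hη2)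
  · have hb : ∀ n, eLpNorm ((fun z => η z • f n z) - fun z => η z • g z) 1 (volume.restrict Ω) ≤
        eLpNorm η 2 (volume.restrict Ω) * eLpNorm (f n - g) 2 (volume.restrict Ω) := by
      intro n
      have := eLpNorm_smul_le_mul_eLpNorm (p := 2) (q := 2) (r := 1)
        ((hf n).sub hg).1 hη2.1
      convert this using 2
      ext z
      simp [smul_sub]
    have h0 : Tendsto (fun n => eLpNorm η 2 (volume.restrict Ω) *
        eLpNorm (f n - g) 2 (volume.restrict Ω)) atTop (𝓝 0) := by
      have := ENNReal.Tendsto.const_mul h (Or.inr hη2.2.ne)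
      simpa using this
    exact tendsto_of_tendsto_of_tendsto_of_le_of_le tendsto_const_nhds h0 (fun _ => zero_le) hb

/-- Both sides of the integration-by-parts identity pass to the limit, being $L^2$ pairings with a
fixed test function. -/
lemma HasWeakFDerivOn.of_tendsto {Ω : Set ℂ} {f : ℕ → ℂ → F}
    {D : ℕ → ℂ → ℂ →L[ℝ] F} {g : ℂ → F} {G : ℂ → ℂ →L[ℝ] F}
    (h : ∀ n, HasWeakFDerivOn Ω (f n) (D n))
    (hf : ∀ n, MemLp (f n) 2 (volume.restrict Ω)) (hD : ∀ n, MemLp (D n) 2 (volume.restrict Ω))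
    (hg : MemLp g 2 (volume.restrict Ω)) (hG : MemLp G 2 (volume.restrict Ω))
    (hfg : Tendsto (fun n => eLpNorm (f n - g) 2 (volume.restrict Ω)) atTop (𝓝 0))
    (hDG : Tendsto (fun n => eLpNorm (D n - G) 2 (volume.restrict Ω)) atTop (𝓝 0)) :
    HasWeakFDerivOn Ω g G where
  locInt := locallyIntegrableOn_of_locallyIntegrable_restrict (hg.locallyIntegrable (by norm_num))
  locInt_deriv :=
    locallyIntegrableOn_of_locallyIntegrable_restrict (hG.locallyIntegrable (by norm_num))
  integral_eq η hη v := by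
    have t1 := tendsto_setIntegral_smul_of_eLpNorm (hη.fderiv_apply v).continuous
      (hη.fderiv_apply v).2.1 hf hg hfg
    have hbound : ∀ L : ℂ → ℂ →L[ℝ] F, eLpNorm (fun z => L z v) 2 (volume.restrict Ω) ≤
        ENNReal.ofReal ‖v‖ * eLpNorm L 2 (volume.restrict Ω) := fun L =>
      eLpNorm_le_mul_eLpNorm_of_ae_le_mul (Eventually.of_forall fun z => by
        rw [mul_comm]; exact (L z).le_opNorm v) 2
    have hL : ∀ L : ℂ → ℂ →L[ℝ] F, MemLp L 2 (volume.restrict Ω) →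
        MemLp (fun z => L z v) 2 (volume.restrict Ω) := fun L hL =>
      ⟨(ContinuousLinearMap.apply ℝ F v).continuous.comp_aestronglyMeasurable hL.1,
        (hbound L).trans_lt (ENNReal.mul_lt_top ENNReal.ofReal_lt_top hL.2)⟩
    have t2 := tendsto_setIntegral_smul_of_eLpNorm hη.continuous hη.2.1
      (fun n => hL _ (hD n)) (hL _ hG) (by
        have := ENNReal.Tendsto.const_mul hDG (Or.inr (ENNReal.ofReal_ne_top (r := ‖v‖)))
        rw [mul_zero] at this
        exact tendsto_of_tendsto_of_tendsto_of_le_of_le tendsto_const_nhds this (fun _ => zero_le)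
          fun n => hbound (D n - G))
    simp only [fun n => (h n).integral_eq η hη v] at t1
    exact tendsto_nhds_unique t1 t2.neg

end WeakDerivative

/-! ### Mollification, and local Lipschitz bounds from bounded weak derivatives. -/

section Mollification

variable {F : Type*} [NormedAddCommGroup F] [NormedSpace ℝ F]

/-- Convolution of `g` with the normalized bump function `ρ`. -/
abbrev mollify (ρ : ContDiffBump (0 : ℂ)) (g : ℂ → F) : ℂ → F :=
  ρ.normed volume ⋆[ContinuousLinearMap.lsmul ℝ ℝ, volume] g

lemma tsupport_bump_sub (ρ : ContDiffBump (0 : ℂ)) (y : ℂ) :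
    tsupport (fun t => ρ.normed volume (y - t)) ⊆ closedBall y ρ.rOut := by
  refine closure_minimal (fun t ht => ?_) isClosed_closedBall
  have h : y - t ∈ Function.support (ρ.normed volume) := ht
  rw [ρ.support_normed_eq, mem_ball_zero_iff] at h
  rw [mem_closedBall, dist_comm, dist_eq_norm]
  exact h.le

lemma isTestFunction_bump_sub (ρ : ContDiffBump (0 : ℂ)) {U : Set ℂ} {y : ℂ}
    (h : closedBall y ρ.rOut ⊆ U) : IsTestFunction U (fun t => ρ.normed volume (y - t)) := by
  refine ⟨ρ.contDiff_normed.comp (contDiff_const.sub contDiff_id), ?_,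
    (tsupport_bump_sub ρ y).trans h⟩
  exact (isCompact_closedBall y ρ.rOut).of_isClosed_subset (isClosed_tsupport _)
    (tsupport_bump_sub ρ y)

lemma fderiv_bump_sub (ρ : ContDiffBump (0 : ℂ)) (y t : ℂ) :
    fderiv ℝ (fun t => ρ.normed volume (y - t)) t = -fderiv ℝ (ρ.normed volume) (y - t) := by
  have h1 : HasFDerivAt (ρ.normed volume) (fderiv ℝ (ρ.normed volume) (y - t)) (y - t) :=
    ((ρ.contDiff_normed (n := 1)).differentiable (by simp) _).hasFDerivAt
  have h2 : HasFDerivAt (fun t : ℂ => y - t) (-ContinuousLinearMap.id ℝ ℂ) t :=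
    (hasFDerivAt_id t).const_sub y
  rw [show fderiv ℝ (fun t => ρ.normed volume (y - t)) t = _ from (h1.comp t h2).fderiv]
  ext v
  simp

/-- The derivative of the convolution first falls on the kernel. The function $t\mapsto\rho(y-t)$ is
a test function on $U$ because of the ball condition, so the weak identity moves the derivative onto
$g$; the two minus signs cancel. -/
lemma HasWeakFDerivOn.hasFDerivAt_mollify [CompleteSpace F] {U : Set ℂ} {g : ℂ → F}
    {D : ℂ → ℂ →L[ℝ] F} (h : HasWeakFDerivOn U g D) (hg : LocallyIntegrable g)
    (ρ : ContDiffBump (0 : ℂ)) {y : ℂ} (hy : closedBall y ρ.rOut ⊆ U) :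
    HasFDerivAt (mollify ρ g) (∫ t, ρ.normed volume (y - t) • D t) y := by
  have h1 := ρ.hasCompactSupport_normed (μ := volume) |>.hasFDerivAt_convolution_left
    (ContinuousLinearMap.lsmul ℝ ℝ : ℝ →L[ℝ] F →L[ℝ] F) (ρ.contDiff_normed (n := 1)) hg y
  suffices e : (∫ t, ρ.normed volume (y - t) • D t) =
      (fderiv ℝ (ρ.normed volume) ⋆[(ContinuousLinearMap.lsmul ℝ ℝ :
        ℝ →L[ℝ] F →L[ℝ] F).precompL ℂ, volume] g) y by
    rw [e]; exact h1
  have hη := isTestFunction_bump_sub ρ hy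
  rw [convolution_eq_swap]
  have hcont : Continuous fun t => fderiv ℝ (ρ.normed (volume : Measure ℂ)) (y - t) :=
    ((ρ.contDiff_normed (n := 1)).continuous_fderiv (by simp)).comp
      (continuous_const.sub continuous_id)
  have hint : Integrable fun t => (((ContinuousLinearMap.lsmul ℝ ℝ : ℝ →L[ℝ] F →L[ℝ] F).precompL ℂ)
      (fderiv ℝ (ρ.normed (volume : Measure ℂ)) (y - t))) (g t) := by
    have hc := (ρ.hasCompactSupport_normed (μ := (volume : Measure ℂ))).fderiv (𝕜 := ℝ)
      |>.convolutionExists_left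
      ((ContinuousLinearMap.lsmul ℝ ℝ : ℝ →L[ℝ] F →L[ℝ] F).precompL ℂ)
      ((ρ.contDiff_normed (n := 1)).continuous_fderiv (by simp)) hg y
    exact (convolutionExistsAt_iff_integrable_swap).1 hc
  ext v
  rw [ContinuousLinearMap.integral_apply (hη.integrable_smul h.locInt_deriv),
    ContinuousLinearMap.integral_apply hint]
  have key := h.integral_eq _ hη v
  rw [setIntegral_fderiv_smul_eq_integral hη.2.2, setIntegral_smul_eq_integral hη.2.2] at key
  simp only [fderiv_bump_sub, neg_apply, neg_smul, integral_neg, neg_inj] at key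
  simp only [smul_apply, ContinuousLinearMap.precompL_apply,
    ContinuousLinearMap.lsmul_apply]
  exact key.symm

lemma integral_bump_sub (ρ : ContDiffBump (0 : ℂ)) (y : ℂ) :
    ∫ t, ρ.normed volume (y - t) = 1 := by
  rw [integral_sub_left_eq_self (fun t => ρ.normed volume t) volume y, ρ.integral_normed]

lemma norm_integral_bump_smul_le {U : Set ℂ} (hU : MeasurableSet U) {D : ℂ → F} {M : ℝ}
    (hD : ∀ᵐ z ∂(volume.restrict U), ‖D z‖ ≤ M) (ρ : ContDiffBump (0 : ℂ)) {y : ℂ}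
    (hy : closedBall y ρ.rOut ⊆ U) : ‖∫ t, ρ.normed volume (y - t) • D t‖ ≤ M := by
  have hη := isTestFunction_bump_sub ρ hy
  have hint : Integrable fun t => ρ.normed volume (y - t) * M :=
    (hη.continuous.integrable_of_hasCompactSupport hη.2.1).mul_const M
  calc ‖∫ t, ρ.normed volume (y - t) • D t‖ ≤ ∫ t, ρ.normed volume (y - t) * M := by
        refine norm_integral_le_of_norm_le hint ?_
        filter_upwards [(ae_restrict_iff' hU).1 hD] with t ht
        rw [norm_smul, Real.norm_of_nonneg (ρ.nonneg_normed _)]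
        by_cases htU : t ∈ U
        · exact mul_le_mul_of_nonneg_left (ht htU) (ρ.nonneg_normed _)
        · have : ρ.normed volume (y - t) = 0 :=
            image_eq_zero_of_notMem_tsupport (f := fun t => ρ.normed volume (y - t))
              fun h => htU (hy (tsupport_bump_sub ρ y h))
          simp [this]
    _ = M := by rw [integral_mul_const, integral_bump_sub, one_mul]

/-- A sequence of bump functions shrinking to the origin. -/
def bumpSeq (n : ℕ) : ContDiffBump (0 : ℂ) where
  rIn := 1 / (2 * ((n : ℝ) + 1))
  rOut := 1 / ((n : ℝ) + 1)
  rIn_pos := by positivity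
  rIn_lt_rOut := by
    apply one_div_lt_one_div_of_lt <;> [positivity; linarith [(n.cast_nonneg : (0 : ℝ) ≤ n)]]

lemma bumpSeq_rOut (n : ℕ) : (bumpSeq n).rOut = 1 / ((n : ℝ) + 1) := rfl

lemma tendsto_bumpSeq_rOut : Tendsto (fun n => (bumpSeq n).rOut) atTop (𝓝 0) :=
  tendsto_one_div_add_atTop_nhds_zero_nat

/-- The bounded ratio of radii is what Lebesgue differentiation needs for a.e. convergence of
mollifications. -/
lemma bumpSeq_rOut_le (n : ℕ) : (bumpSeq n).rOut ≤ 2 * (bumpSeq n).rIn := by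
  have : (0 : ℝ) < (n : ℝ) + 1 := by positivity
  change 1 / ((n : ℝ) + 1) ≤ 2 * (1 / (2 * ((n : ℝ) + 1)))
  apply le_of_eq
  field_simp

lemma bumpSeq_rOut_le_one (n : ℕ) : (bumpSeq n).rOut ≤ 1 := by
  rw [bumpSeq_rOut, div_le_one (by positivity)]
  linarith [(n.cast_nonneg : (0 : ℝ) ≤ n)]

/-- A continuous function with essentially bounded weak derivative is Lipschitz on small balls. -/
lemma HasWeakFDerivOn.lipschitzOnWith_ball [CompleteSpace F] [FiniteDimensional ℝ F] {Ω : Set ℂ}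
    {f : ℂ → F} {D : ℂ → ℂ →L[ℝ] F} (h : HasWeakFDerivOn Ω f D)
    (hf : ContinuousOn f Ω) {M : ℝ≥0} (hM : ∀ᵐ z ∂(volume.restrict Ω), ‖D z‖ ≤ M)
    {x : ℂ} {r : ℝ} (hr : closedBall x r ⊆ Ω) : LipschitzOnWith M f (ball x (r / 2)) := by
  rcases le_or_gt r 0 with h0 | h0
  · rw [ball_eq_empty.2 (by linarith)]; simp
  set B := ball x r
  have hBΩ : B ⊆ Ω := ball_subset_closedBall.trans hr
  -- Cutting off makes the function integrable on the whole plane, so that it can be convolved; for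
  -- kernels of radius below `r / 2`, points of the half ball see only `B`.
  set g := B.indicator f
  have hg : Integrable g := by
    rw [integrable_indicator_iff measurableSet_ball]
    exact ((hf.mono hr).integrableOn_compact (isCompact_closedBall x r)).mono_set
      ball_subset_closedBall
  have hfg : f =ᵐ[volume.restrict B] g := by
    filter_upwards [ae_restrict_mem measurableSet_ball] with z hz
    exact (indicator_of_mem hz f).symm
  have hw : HasWeakFDerivOn B g D := (h.mono hBΩ).congr hfg (ae_eq_refl _)
  have hMB : ∀ᵐ z ∂(volume.restrict B), ‖D z‖ ≤ M := ae_restrict_of_ae_restrict_of_subset hBΩ hM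
  have hsmall : ∀ᶠ n in atTop, (bumpSeq n).rOut < r / 2 :=
    tendsto_bumpSeq_rOut.eventually_lt_const (by linarith)
  have hlip : ∀ᶠ n in atTop, LipschitzOnWith M (mollify (bumpSeq n) g) (ball x (r / 2)) := by
    filter_upwards [hsmall] with n hn
    have hsub : ∀ y ∈ ball x (r / 2), closedBall y (bumpSeq n).rOut ⊆ B := by
      intro y hy
      refine closedBall_subset_ball' ?_
      rw [mem_ball] at hy
      linarith
    refine (convex_ball x (r / 2)).lipschitzOnWith_of_nnnorm_hasFDerivWithin_le
      (f' := fun y => ∫ t, (bumpSeq n).normed volume (y - t) • D t)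
      (fun y hy => (hw.hasFDerivAt_mollify hg.locallyIntegrable _ (hsub y hy)).hasFDerivWithinAt) ?_
    intro y hy
    exact norm_integral_bump_smul_le measurableSet_ball hMB _ (hsub y hy)
  have hlim : ∀ y ∈ ball x (r / 2), Tendsto (fun n => mollify (bumpSeq n) g y) atTop (𝓝 (f y)) := by
    intro y hy
    have hyB : y ∈ B := ball_subset_ball (by linarith) hy
    refine ContDiffBump.convolution_tendsto_right tendsto_bumpSeq_rOut
      (Eventually.of_forall fun _ => hg.aestronglyMeasurable) ?_ tendsto_const_nhds
    have hB : B ∈ 𝓝 y := isOpen_ball.mem_nhds hyB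
    have hc : Tendsto g (𝓝 y) (𝓝 (f y)) := by
      refine (((hf.mono hBΩ).continuousAt hB).tendsto).congr' ?_
      filter_upwards [hB] with z hz
      exact (indicator_of_mem hz f).symm
    exact hc.comp tendsto_snd
  refine LipschitzOnWith.of_dist_le_mul fun y hy z hz => ?_
  refine le_of_tendsto ((hlim y hy).dist (hlim z hz)) ?_
  filter_upwards [hlip] with n hn
  exact hn.dist_le_mul y hy z hz

end Mollification

/-! ### Lipschitz functions: weak derivatives and approximation by test functions. -/

section Lipschitz

lemma lipschitz_norm_fderiv_le {F : Type*} [NormedAddCommGroup F] [NormedSpace ℝ F] {u : ℂ → F}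
    {C : ℝ≥0} (hu : LipschitzWith C u) (z : ℂ) : ‖fderiv ℝ u z‖ ≤ C :=
  norm_fderiv_le_of_lipschitz ℝ hu

lemma locallyIntegrable_fderiv {u : ℂ → ℝ} {C : ℝ≥0} (hu : LipschitzWith C u) :
    LocallyIntegrable (fderiv ℝ u) :=
  (memLp_top_of_bound (measurable_fderiv ℝ u).aestronglyMeasurable C
    (Eventually.of_forall (lipschitz_norm_fderiv_le hu))).locallyIntegrable le_top

/-- Integration by parts for line derivatives of Lipschitz functions, which by Rademacher are a.e.
the values of `fderiv`. -/
lemma hasWeakFDerivOn_of_lipschitzWith {u : ℂ → ℝ} {C : ℝ≥0} (hu : LipschitzWith C u)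
    (U : Set ℂ) : HasWeakFDerivOn U u (fderiv ℝ u) where
  locInt := hu.continuous.locallyIntegrable.locallyIntegrableOn U
  locInt_deriv := (locallyIntegrable_fderiv hu).locallyIntegrableOn U
  integral_eq η hη v := by
    rw [setIntegral_fderiv_smul_eq_integral hη.2.2, setIntegral_smul_eq_integral hη.2.2]
    obtain ⟨C', hC'⟩ := hη.1.lipschitzWith_of_hasCompactSupport hη.2.1 (by simp)
    have h := hu.integral_lineDeriv_mul_eq (μ := volume) hC' hη.2.1 v
    have e1 : ∀ᵐ z, lineDeriv ℝ u z v * η z = η z • fderiv ℝ u z v := by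
      filter_upwards [hu.ae_differentiableAt] with z hz
      rw [hz.lineDeriv_eq_fderiv, mul_comm, smul_eq_mul]
    have e2 : ∀ z, lineDeriv ℝ η z (-v) * u z = -(fderiv ℝ η z v • u z) := fun z => by
      rw [(hη.differentiable z).lineDeriv_eq_fderiv, map_neg, neg_mul, smul_eq_mul]
    rw [integral_congr_ae e1] at h
    simp only [e2, integral_neg] at h
    rw [h, neg_neg]

/-- Compactly supported Lipschitz functions are approximated, together with their first
derivatives, boundedly and almost everywhere by test functions. -/
lemma exists_testFunction_tendsto {u : ℂ → ℝ} {C : ℝ≥0} (hu : LipschitzWith C u) {Ω : Set ℂ}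
    (hΩ : IsOpen Ω) (hc : HasCompactSupport u) (hs : tsupport u ⊆ Ω) :
    ∃ K : Set ℂ, IsCompact K ∧ K ⊆ Ω ∧ tsupport u ⊆ K ∧ ∃ η : ℕ → ℂ → ℝ,
      (∀ n, IsTestFunction Ω (η n)) ∧ (∀ n, tsupport (η n) ⊆ K) ∧
      (∀ n z, ‖η n z - u z‖ ≤ C) ∧ (∀ n z, ‖fderiv ℝ (η n) z‖ ≤ C) ∧
      (∀ z, Tendsto (fun n => η n z) atTop (𝓝 (u z))) ∧
      ∀ᵐ z, Tendsto (fun n => fderiv ℝ (η n) z) atTop (𝓝 (fderiv ℝ u z)) := by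
  obtain ⟨δ, hδ, hδΩ⟩ := hc.isCompact.exists_cthickening_subset_open hΩ hs
  -- Shifting the sequence by `N` keeps every mollification supported in one compact neighbourhood
  -- of the support inside `Ω`.
  obtain ⟨N, hN⟩ := (tendsto_bumpSeq_rOut.eventually_lt_const hδ).exists_forall_of_atTop
  have hw := hasWeakFDerivOn_of_lipschitzWith hu univ
  have hui : LocallyIntegrable u := hu.continuous.locallyIntegrable
  have hfd : ∀ n z, HasFDerivAt (mollify (bumpSeq n) u) (mollify (bumpSeq n) (fderiv ℝ u) z) z := by
    intro n z
    rw [show mollify (bumpSeq n) (fderiv ℝ u) z = _ from convolution_lsmul_swap]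
    exact hw.hasFDerivAt_mollify hui _ (subset_univ _)
  have hsupp : ∀ n, tsupport (mollify (bumpSeq (n + N)) u) ⊆ cthickening δ (tsupport u) := by
    intro n
    refine closure_minimal (fun z hz => ?_) isClosed_cthickening
    obtain ⟨a, ha, b, hb, rfl⟩ := support_convolution_subset_swap _ hz
    rw [(bumpSeq (n + N)).support_normed_eq, mem_ball_zero_iff] at hb
    refine mem_cthickening_of_dist_le _ a _ _ (subset_tsupport _ ha) ?_
    rw [dist_eq_norm, add_sub_cancel_left]
    exact (hb.trans (hN _ (by omega))).le
  refine ⟨cthickening δ (tsupport u), hc.isCompact.cthickening, hδΩ, self_subset_cthickening _,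
    fun n => mollify (bumpSeq (n + N)) u, fun n => ⟨?_, ?_, (hsupp n).trans hδΩ⟩, hsupp, ?_, ?_, ?_,
    ?_⟩
  · exact (bumpSeq (n + N)).hasCompactSupport_normed.contDiff_convolution_left _
      (bumpSeq (n + N)).contDiff_normed hui
  · exact hc.isCompact.cthickening.of_isClosed_subset (isClosed_tsupport _) (hsupp n)
  · intro n z
    rw [← dist_eq_norm]
    refine ContDiffBump.dist_normed_convolution_le hu.continuous.aestronglyMeasurable ?_
    intro y hy
    refine (hu.dist_le_mul y z).trans ?_
    have : dist y z ≤ 1 := (mem_ball.1 hy).le.trans (bumpSeq_rOut_le_one _)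
    exact mul_le_of_le_one_right C.2 this
  · intro n z
    rw [(hfd _ z).fderiv, mollify, convolution_lsmul_swap]
    exact norm_integral_bump_smul_le MeasurableSet.univ
      (Eventually.of_forall (lipschitz_norm_fderiv_le hu)) _ (subset_univ _)
  · intro z
    exact ContDiffBump.convolution_tendsto_right_of_continuous
      (tendsto_bumpSeq_rOut.comp (tendsto_add_atTop_nat N)) hu.continuous z
  · filter_upwards [ContDiffBump.ae_convolution_tendsto_right_of_locallyIntegrable
      (φ := fun n => bumpSeq (n + N)) (l := atTop) (K := 2)
      (tendsto_bumpSeq_rOut.comp (tendsto_add_atTop_nat N))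
      (Eventually.of_forall fun n => bumpSeq_rOut_le _) (locallyIntegrable_fderiv hu)] with z hz
    refine hz.congr fun n => ?_
    rw [(hfd _ z).fderiv]

/-- Dominated convergence in `L²` for functions vanishing off a set of finite measure. -/
lemma tendsto_eLpNorm_two_of_bounded {E : Type*} [NormedAddCommGroup E] {f : ℕ → ℂ → E}
    {K : Set ℂ} (hK : IsCompact K) (hf : ∀ n, AEStronglyMeasurable (f n)) (C : ℝ)
    (hb : ∀ n z, ‖f n z‖ ≤ C) (hs : ∀ n, ∀ z ∉ K, f n z = 0)
    (hlim : ∀ᵐ z, Tendsto (fun n => f n z) atTop (𝓝 0)) :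
    Tendsto (fun n => eLpNorm (f n) 2 volume) atTop (𝓝 0) := by
  have h2 : ∀ g : ℂ → E, eLpNorm g 2 volume = (∫⁻ z, ‖g z‖ₑ ^ (2 : ℝ)) ^ (1 / 2 : ℝ) := fun g => by
    rw [eLpNorm_eq_lintegral_rpow_enorm_toReal (by norm_num) (by norm_num)]; simp
  simp only [h2]
  have h0 : Tendsto (fun n => ∫⁻ z, ‖f n z‖ₑ ^ (2 : ℝ)) atTop (𝓝 (∫⁻ _ : ℂ, 0)) := by
    refine tendsto_lintegral_of_dominated_convergence'
      (K.indicator fun _ => ENNReal.ofReal C ^ (2 : ℝ)) ?_ ?_ ?_ ?_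
    · exact fun n => (hf n).enorm.pow_const _
    · refine fun n => Eventually.of_forall fun z => ?_
      by_cases hz : z ∈ K
      · rw [indicator_of_mem hz]
        refine ENNReal.rpow_le_rpow ?_ (by norm_num)
        rw [← ofReal_norm]
        exact ENNReal.ofReal_le_ofReal (hb n z)
      · simp [hs n z hz]
    · rw [lintegral_indicator hK.measurableSet, setLIntegral_const]
      exact (ENNReal.mul_lt_top (by simp) hK.measure_lt_top).ne
    · filter_upwards [hlim] with z hz
      have : Tendsto (fun n => ‖f n z‖ₑ) atTop (𝓝 0) := by simpa using hz.enorm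
      simpa using this.ennrpow_const 2
  simpa using h0.ennrpow_const (1 / 2)

lemma exists_testFunction_eLpNorm_tendsto {u : ℂ → ℝ} {C : ℝ≥0} (hu : LipschitzWith C u)
    {Ω : Set ℂ} (hΩ : IsOpen Ω) (hc : HasCompactSupport u) (hs : tsupport u ⊆ Ω) :
    ∃ η : ℕ → ℂ → ℝ, (∀ n, IsTestFunction Ω (η n)) ∧
      Tendsto (fun n => eLpNorm (u - η n) 2 volume) atTop (𝓝 0) ∧
      Tendsto (fun n => eLpNorm (fderiv ℝ u - fderiv ℝ (η n)) 2 volume) atTop (𝓝 0) := by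
  obtain ⟨K, hK, -, huK, η, h1, h2, h3, h4, h5, h6⟩ := exists_testFunction_tendsto hu hΩ hc hs
  refine ⟨η, h1, ?_, ?_⟩
  · refine tendsto_eLpNorm_two_of_bounded hK
      (fun n => (hu.continuous.sub (h1 n).continuous).aestronglyMeasurable) C ?_ ?_ ?_
    · intro n z
      rw [Pi.sub_apply, norm_sub_rev]
      exact h3 n z
    · intro n z hz
      rw [Pi.sub_apply, image_eq_zero_of_notMem_tsupport fun h => hz (huK h),
        image_eq_zero_of_notMem_tsupport fun h => hz (h2 n h), sub_zero]
    · refine Eventually.of_forall fun z => ?_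
      simpa using (h5 z).const_sub (u z)
  · refine tendsto_eLpNorm_two_of_bounded hK
      (fun n => ((measurable_fderiv ℝ u).sub (measurable_fderiv ℝ (η n))).aestronglyMeasurable)
      (C + C) ?_ ?_ ?_
    · intro n z
      exact (norm_sub_le _ _).trans (add_le_add (lipschitz_norm_fderiv_le hu z) (h4 n z))
    · intro n z hz
      have e : ∀ w : ℂ → ℝ, tsupport w ⊆ K → fderiv ℝ w z = 0 := fun w hw =>
        image_eq_zero_of_notMem_tsupport fun h => hz (hw (tsupport_fderiv_subset ℝ h))
      rw [Pi.sub_apply, e u huK, e _ (h2 n), sub_zero]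
    · filter_upwards [h6] with z hz
      simpa using hz.const_sub (fderiv ℝ u z)

end Lipschitz

/-! ### Rademacher's theorem, Lusin's property (N) and change of variables. -/

section ChangeOfVariables

lemma HasWeakFDerivOn.clm_comp {F G : Type*} [NormedAddCommGroup F] [NormedSpace ℝ F]
    [NormedAddCommGroup G] [NormedSpace ℝ G] [CompleteSpace F] [CompleteSpace G] {Ω : Set ℂ}
    {f : ℂ → F} {D : ℂ → ℂ →L[ℝ] F} (h : HasWeakFDerivOn Ω f D) (L : F →L[ℝ] G) :
    HasWeakFDerivOn Ω (fun z => L (f z)) (fun z => L.comp (D z)) where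
  locInt z hz := by
    obtain ⟨s, hs, hi⟩ := h.locInt z hz
    exact ⟨s, hs, L.integrable_comp hi⟩
  locInt_deriv z hz := by
    obtain ⟨s, hs, hi⟩ := h.locInt_deriv z hz
    exact ⟨s, hs, (ContinuousLinearMap.compL ℝ ℂ F G L).integrable_comp hi⟩
  integral_eq η hη v := by
    have i1 := ((hη.fderiv_apply v).integrable_smul h.locInt).integrableOn (s := Ω)
    have i2 := (hη.integrable_smul (h.locInt_deriv.clm_apply_const v)).integrableOn (s := Ω)
    have e1 := L.integral_comp_comm i1
    have e2 := L.integral_comp_comm i2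
    simp only [map_smul] at e1 e2
    simp only [ContinuousLinearMap.comp_apply]
    rw [e1, e2, h.integral_eq η hη v, map_neg]

lemma ae_restrict_of_forall_exists_ball {Ω : Set ℂ} (hΩ : IsOpen Ω) {p : ℂ → Prop}
    (h : ∀ x ∈ Ω, ∃ r > 0, ∀ᵐ z ∂(volume.restrict (ball x r)), p z) :
    ∀ᵐ z ∂(volume.restrict Ω), p z := by
  rw [ae_restrict_iff' hΩ.measurableSet, ae_iff]
  refine measure_null_of_locally_null _ fun x hx => ?_
  have hxΩ : x ∈ Ω := by
    by_contra hx'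
    exact hx fun h => (hx' h).elim
  obtain ⟨r, hr, h⟩ := h x hxΩ
  rw [ae_restrict_iff' measurableSet_ball, ae_iff] at h
  refine ⟨_, inter_mem_nhdsWithin _ (ball_mem_nhds x hr), measure_mono_null ?_ h⟩
  rintro z ⟨hz, hzr⟩ hp
  exact hz fun _ => hp hzr

lemma HasWeakFDerivOn.exists_lipschitzOnWith_ball {F : Type*} [NormedAddCommGroup F]
    [NormedSpace ℝ F] [CompleteSpace F] [FiniteDimensional ℝ F] {Ω : Set ℂ} (hΩ : IsOpen Ω)
    {f : ℂ → F} {D : ℂ → ℂ →L[ℝ] F}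
    (h : HasWeakFDerivOn Ω f D) (hf : ContinuousOn f Ω) {M : ℝ≥0}
    (hM : ∀ᵐ z ∂(volume.restrict Ω), ‖D z‖ ≤ M) {x : ℂ} (hx : x ∈ Ω) :
    ∃ r > 0, ball x r ⊆ Ω ∧ LipschitzOnWith M f (ball x r) := by
  obtain ⟨r, hr, hrΩ⟩ := nhds_basis_closedBall.mem_iff.1 (hΩ.mem_nhds hx)
  exact ⟨r / 2, by positivity, ((ball_subset_ball (by linarith)).trans ball_subset_closedBall).trans
    hrΩ, h.lipschitzOnWith_ball hf hM hrΩ⟩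

/-- **Rademacher's theorem** in terms of a bounded weak derivative. -/
lemma HasWeakFDerivOn.ae_hasFDerivAt {Ω : Set ℂ} (hΩ : IsOpen Ω) {f : ℂ → ℂ} {D : ℂ → ℂ →L[ℝ] ℂ}
    (h : HasWeakFDerivOn Ω f D) (hf : ContinuousOn f Ω) {M : ℝ≥0}
    (hM : ∀ᵐ z ∂(volume.restrict Ω), ‖D z‖ ≤ M) :
    ∀ᵐ z ∂(volume.restrict Ω), HasFDerivAt f (D z) z := by
  refine ae_restrict_of_forall_exists_ball hΩ fun x hx => ?_
  obtain ⟨r, hr, hrΩ, hlip⟩ := h.exists_lipschitzOnWith_ball hΩ hf hM hx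
  refine ⟨r, hr, ?_⟩
  have hdiff : ∀ᵐ z ∂(volume.restrict (ball x r)), DifferentiableAt ℝ f z := by
    rw [ae_restrict_iff' measurableSet_ball]
    filter_upwards [hlip.ae_differentiableWithinAt_of_mem (μ := volume)] with z hz hzB
    exact (hz hzB).differentiableAt (isOpen_ball.mem_nhds hzB)
  have key : ∀ L : ℂ →L[ℝ] ℝ,
      ∀ᵐ z ∂(volume.restrict (ball x r)), L.comp (D z) = L.comp (fderiv ℝ f z) := by
    intro L
    -- A real coordinate of `f` extends from the ball to a globally Lipschitz function, whose
    -- classical derivative is its weak one; uniqueness identifies it with `D` on the ball.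
    obtain ⟨g, hg, hgf⟩ := (L.lipschitz.comp_lipschitzOnWith hlip).extend_real
    have h1 := (h.mono hrΩ).clm_comp L
    have h2 := (hasWeakFDerivOn_of_lipschitzWith hg (ball x r)).congr (g := fun z => L (f z))
      (by
        filter_upwards [ae_restrict_mem measurableSet_ball] with z hz
        exact (hgf hz).symm) (ae_eq_refl _)
    filter_upwards [h1.ae_eq isOpen_ball h2, hdiff, ae_restrict_mem measurableSet_ball]
      with z hz hd hzB
    have hev : g =ᶠ[𝓝 z] fun z => L (f z) := by
      filter_upwards [isOpen_ball.mem_nhds hzB] with w hw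
      exact (hgf hw).symm
    rw [hz, hev.fderiv_eq]
    exact (L.hasFDerivAt.comp z hd.hasFDerivAt).fderiv
  filter_upwards [key Complex.reCLM, key Complex.imCLM, hdiff] with z h1 h2 h3
  have : D z = fderiv ℝ f z := by
    ext v
    exact Complex.ext (DFunLike.congr_fun h1 v) (DFunLike.congr_fun h2 v)
  rw [this]
  exact h3.hasFDerivAt

/-- Two-dimensional Hausdorff measure scales by at most $C^2$ under the map and has the same null
sets as Lebesgue measure. -/
lemma volume_image_eq_zero_of_lipschitzOnWith {f : ℂ → ℂ} {s : Set ℂ} {C : ℝ≥0}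
    (hf : LipschitzOnWith C f s) (hs : volume s = 0) : volume (f '' s) = 0 := by
  have h1 : (volume : Measure ℂ) ≪ Measure.hausdorffMeasure (Module.finrank ℝ ℂ : ℝ) :=
    Measure.absolutelyContinuous_isAddHaarMeasure _ _
  have h2 : Measure.hausdorffMeasure (Module.finrank ℝ ℂ : ℝ) ≪ (volume : Measure ℂ) :=
    Measure.absolutelyContinuous_isAddHaarMeasure _ _
  apply h1
  refine le_antisymm ((hf.hausdorffMeasure_image_le (Nat.cast_nonneg _)).trans ?_) zero_le
  rw [h2 hs, mul_zero]

/-- A locally Lipschitz map has Lusin's property (N). -/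
lemma volume_image_eq_zero {f : ℂ → ℂ} {s : Set ℂ}
    (hf : ∀ x ∈ s, ∃ r > 0, ∃ C : ℝ≥0, LipschitzOnWith C f (ball x r)) (hs : volume s = 0) :
    volume (f '' s) = 0 := by
  choose! r hr hL using hf
  obtain ⟨t, hts, htc, hst⟩ := TopologicalSpace.countable_cover_nhdsWithin
    (f := fun x => ball x (r x)) (s := s)
    fun x hx => mem_nhdsWithin_of_mem_nhds (ball_mem_nhds x (hr x hx))
  have : f '' s ⊆ ⋃ x ∈ t, f '' (s ∩ ball x (r x)) := by
    rintro _ ⟨z, hz, rfl⟩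
    obtain ⟨x, hx, hzx⟩ := mem_iUnion₂.1 (hst hz)
    exact mem_iUnion₂.2 ⟨x, hx, z, ⟨hz, hzx⟩, rfl⟩
  refine measure_mono_null this ((measure_biUnion_null_iff htc).2 fun x hx => ?_)
  obtain ⟨C, hC⟩ := hL x (hts hx)
  exact volume_image_eq_zero_of_lipschitzOnWith (hC.mono inter_subset_right)
    (measure_mono_null inter_subset_left hs)

/-- A homeomorphism between plane open sets with a bounded weak derivative of determinant `1`. -/
structure IsUnimodular (φ : OpenPartialHomeomorph ℂ ℂ) (P : ℂ → ℂ →L[ℝ] ℂ) : Prop where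
  weak : HasWeakFDerivOn φ.source φ P
  bound : ∃ M : ℝ≥0, ∀ᵐ z ∂(volume.restrict φ.source), ‖P z‖ ≤ M
  det : ∀ᵐ z ∂(volume.restrict φ.source), (P z).det = 1

variable {φ : OpenPartialHomeomorph ℂ ℂ} {P : ℂ → ℂ →L[ℝ] ℂ}

lemma IsUnimodular.ae_hasFDerivAt (h : IsUnimodular φ P) :
    ∀ᵐ z ∂(volume.restrict φ.source), HasFDerivAt φ (P z) z :=
  let ⟨_, hM⟩ := h.bound
  h.weak.ae_hasFDerivAt φ.open_source φ.continuousOn hM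

lemma IsUnimodular.volume_image_eq_zero (h : IsUnimodular φ P) {s : Set ℂ} (hs : s ⊆ φ.source)
    (h0 : volume s = 0) : volume (φ '' s) = 0 := by
  obtain ⟨M, hM⟩ := h.bound
  refine AQuasiconformal.volume_image_eq_zero (fun x hx => ?_) h0
  obtain ⟨r, hr, -, hl⟩ :=
    h.weak.exists_lipschitzOnWith_ball φ.open_source φ.continuousOn hM (hs hx)
  exact ⟨r, hr, M, hl⟩

/-- The exceptional set in the target lies in the image of the one in the source, which is null by
property (N). -/
lemma IsUnimodular.ae_symm (h : IsUnimodular φ P) {p : ℂ → Prop}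
    (hp : ∀ᵐ z ∂(volume.restrict φ.source), p z) :
    ∀ᵐ w ∂(volume.restrict φ.target), p (φ.symm w) := by
  rw [ae_restrict_iff' φ.open_source.measurableSet, ae_iff] at hp
  rw [ae_restrict_iff' φ.open_target.measurableSet, ae_iff]
  refine measure_mono_null ?_ (h.volume_image_eq_zero (s := {z | ¬(z ∈ φ.source → p z)}) ?_ hp)
  · intro w hw
    simp only [mem_ofPred_eq, Classical.not_imp] at hw
    refine ⟨φ.symm w, ?_, φ.right_inv hw.1⟩
    simp only [mem_ofPred_eq, Classical.not_imp]
    exact ⟨φ.map_target hw.1, hw.2⟩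
  · intro z hz
    simp only [mem_ofPred_eq, Classical.not_imp] at hz
    exact hz.1

/-- The change of variables: an exceptional null set removed, the map is differentiable. -/
lemma IsUnimodular.exists_measurableSet (h : IsUnimodular φ P) :
    ∃ s ⊆ φ.source, MeasurableSet s ∧ s =ᵐ[volume] φ.source ∧ (φ '' s : Set ℂ) =ᵐ[volume] φ.target ∧
      (∀ z ∈ s, HasFDerivWithinAt φ (P z) s z) ∧ (∀ z ∈ s, (P z).det = 1) := by
  have hae := h.ae_hasFDerivAt.and h.det
  rw [ae_restrict_iff' φ.open_source.measurableSet, ae_iff] at hae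
  -- A measurable null hull is removed so that the remaining set is measurable, as the area formula
  -- requires; property (N) keeps the removed part of the image null.
  set N := toMeasurable volume {z | ¬(z ∈ φ.source → HasFDerivAt φ (P z) z ∧ (P z).det = 1)}
  have hN : volume N = 0 := by rwa [measure_toMeasurable]
  have hgood : ∀ z ∈ φ.source \ N, HasFDerivAt φ (P z) z ∧ (P z).det = 1 := by
    intro z hz
    by_contra hc
    exact hz.2 (subset_toMeasurable _ _ fun h => hc (h hz.1))
  refine ⟨φ.source \ N, sdiff_subset,
    φ.open_source.measurableSet.diff (measurableSet_toMeasurable _ _), sdiff_null_ae_eq_self hN, ?_,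
    fun z hz => (hgood z hz).1.hasFDerivWithinAt, fun z hz => (hgood z hz).2⟩
  have h0 : volume (φ '' (φ.source ∩ N)) = 0 :=
    h.volume_image_eq_zero inter_subset_left (measure_mono_null inter_subset_right hN)
  refine (LE.le.eventuallyLE ?_).antisymm ?_
  · rintro _ ⟨z, hz, rfl⟩
    exact φ.map_source hz.1
  · refine ae_le_set.2 (measure_mono_null ?_ h0)
    rintro w ⟨hw, hw'⟩
    refine ⟨φ.symm w, ⟨φ.map_target hw, ?_⟩, φ.right_inv hw⟩
    by_contra hc
    exact hw' ⟨φ.symm w, ⟨φ.map_target hw, hc⟩, φ.right_inv hw⟩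

/-- The area formula for an injective map with Jacobian $1$. It needs no measurability of `g`. -/
lemma IsUnimodular.lintegral_comp (h : IsUnimodular φ P) (g : ℂ → ℝ≥0∞) :
    ∫⁻ z in φ.source, g (φ z) = ∫⁻ w in φ.target, g w := by
  obtain ⟨s, hs, hsm, e1, e2, hd, hdet⟩ := h.exists_measurableSet
  rw [← Measure.restrict_congr_set e1, ← Measure.restrict_congr_set e2,
    lintegral_image_eq_lintegral_abs_det_fderiv_mul volume hsm hd (φ.injOn.mono hs)]
  exact setLIntegral_congr_fun hsm fun z hz => by simp [hdet z hz]

lemma IsUnimodular.integral_comp {F : Type*} [NormedAddCommGroup F] [NormedSpace ℝ F]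
    (h : IsUnimodular φ P) (g : ℂ → F) :
    ∫ z in φ.source, g (φ z) = ∫ w in φ.target, g w := by
  obtain ⟨s, hs, hsm, e1, e2, hd, hdet⟩ := h.exists_measurableSet
  rw [← Measure.restrict_congr_set e1, ← Measure.restrict_congr_set e2,
    integral_image_eq_integral_abs_det_fderiv_smul volume hsm hd (φ.injOn.mono hs)]
  exact setIntegral_congr_fun hsm fun z hz => by simp [hdet z hz]

lemma IsUnimodular.aestronglyMeasurable_comp_symm {F : Type*} [NormedAddCommGroup F]
    (h : IsUnimodular φ P) {g : ℂ → F} (hg : AEStronglyMeasurable g (volume.restrict φ.source)) :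
    AEStronglyMeasurable (fun w => g (φ.symm w)) (volume.restrict φ.target) := by
  have h1 : AEStronglyMeasurable (fun w => hg.mk g (φ.symm w)) (volume.restrict φ.target) :=
    hg.stronglyMeasurable_mk.aestronglyMeasurable.comp_aemeasurable
      (φ.continuousOn_symm.aemeasurable φ.open_target.measurableSet)
  refine h1.congr ?_
  filter_upwards [h.ae_symm hg.ae_eq_mk] with w hw
  exact hw.symm

end ChangeOfVariables

/-! ### Pullbacks of test functions are compactly supported Lipschitz functions. -/

section Pullback

variable {φ : OpenPartialHomeomorph ℂ ℂ} {P : ℂ → ℂ →L[ℝ] ℂ}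

lemma _root_.LocallyLipschitz.exists_lipschitzWith_of_hasCompactSupport {u : ℂ → ℝ}
    (hu : LocallyLipschitz u) (hc : HasCompactSupport u) : ∃ C : ℝ≥0, LipschitzWith C u := by
  obtain ⟨C, hC⟩ := (hu.locallyLipschitzOn (s := cthickening 1 (tsupport u))
    ).exists_lipschitzOnWith_of_compact hc.isCompact.cthickening
  obtain ⟨B, hB⟩ := hc.exists_bound_of_continuous hu.continuous
  have hB0 : 0 ≤ B := (norm_nonneg _).trans (hB 0)
  -- Near the support the Lipschitz constant `C` of a compact neighbourhood works; outside it the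
  -- points are at least `1` apart and the bound `B` on `u` suffices.
  have hmain : ∀ x ∈ tsupport u, ∀ y, dist (u x) (u y) ≤ (C + B) * dist x y := by
    intro x hx y
    by_cases hy : y ∈ cthickening 1 (tsupport u)
    · refine (hC.dist_le_mul x (self_subset_cthickening _ hx) y hy).trans ?_
      gcongr
      linarith
    · have hd : 1 ≤ dist x y := by
        by_contra hlt
        exact hy (mem_cthickening_of_dist_le y x 1 _ hx (by rw [dist_comm]; linarith))
      have hy0 : u y = 0 :=
        image_eq_zero_of_notMem_tsupport fun h => hy (self_subset_cthickening _ h)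
      rw [hy0, dist_zero_right]
      nlinarith [hB x, C.2, NNReal.coe_nonneg C]
  refine ⟨C + ⟨B, hB0⟩, LipschitzWith.of_dist_le_mul fun x y => ?_⟩
  by_cases hx : x ∈ tsupport u
  · exact hmain x hx y
  by_cases hy : y ∈ tsupport u
  · rw [dist_comm, dist_comm x]
    exact hmain y hy x
  rw [image_eq_zero_of_notMem_tsupport hx, image_eq_zero_of_notMem_tsupport hy, dist_self]
  positivity

lemma tsupport_indicator_comp {η : ℂ → ℝ} (hη : IsTestFunction φ.target η) :
    tsupport (φ.source.indicator fun z => η (φ z)) ⊆ φ.symm '' tsupport η ∧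
      IsCompact (φ.symm '' tsupport η) ∧ φ.symm '' tsupport η ⊆ φ.source := by
  have hcomp : IsCompact (φ.symm '' tsupport η) :=
    hη.2.1.isCompact.image_of_continuousOn (φ.continuousOn_symm.mono hη.2.2)
  refine ⟨closure_minimal (fun z hz => ?_) hcomp.isClosed, hcomp, ?_⟩
  · have hzs : z ∈ φ.source := by
      by_contra h
      exact hz (indicator_of_notMem h _)
    have : η (φ z) ≠ 0 := by
      rwa [Function.mem_support, indicator_of_mem hzs] at hz
    exact ⟨φ z, subset_tsupport _ this, φ.left_inv hzs⟩
  · rintro _ ⟨w, hw, rfl⟩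
    exact φ.map_target (hη.2.2 hw)

/-- Near points of the source this is a composition of Lipschitz maps; elsewhere the extension by
zero vanishes locally. Compact support makes the local constants uniform. -/
lemma IsUnimodular.exists_lipschitzWith (h : IsUnimodular φ P) {η : ℂ → ℝ}
    (hη : IsTestFunction φ.target η) :
    HasCompactSupport (φ.source.indicator fun z => η (φ z)) ∧
      tsupport (φ.source.indicator fun z => η (φ z)) ⊆ φ.source ∧
      ∃ C : ℝ≥0, LipschitzWith C (φ.source.indicator fun z => η (φ z)) := by
  obtain ⟨h1, h2, h3⟩ := tsupport_indicator_comp hη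
  have hc : HasCompactSupport (φ.source.indicator fun z => η (φ z)) :=
    h2.of_isClosed_subset (isClosed_tsupport _) h1
  refine ⟨hc, h1.trans h3, LocallyLipschitz.exists_lipschitzWith_of_hasCompactSupport ?_ hc⟩
  obtain ⟨M, hM⟩ := h.bound
  obtain ⟨C, hC⟩ := hη.1.lipschitzWith_of_hasCompactSupport hη.2.1 (by simp)
  intro x
  by_cases hx : x ∈ φ.source
  · obtain ⟨r, hr, hrs, hl⟩ :=
      h.weak.exists_lipschitzOnWith_ball φ.open_source φ.continuousOn hM hx
    refine ⟨C * M, ball x r, ball_mem_nhds x hr, ?_⟩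
    intro z hz w hw
    rw [indicator_of_mem (hrs hz), indicator_of_mem (hrs hw)]
    exact (hC.comp_lipschitzOnWith hl) hz hw
  · have hx' : x ∉ tsupport (φ.source.indicator fun z => η (φ z)) := fun h => hx (h3 (h1 h))
    refine ⟨0, _, (isClosed_tsupport _).isOpen_compl.mem_nhds hx', ?_⟩
    intro z hz w hw
    rw [image_eq_zero_of_notMem_tsupport hz, image_eq_zero_of_notMem_tsupport hw]
    simp

lemma IsUnimodular.fderiv_indicator_comp (h : IsUnimodular φ P) {η : ℂ → ℝ}
    (hη : IsTestFunction φ.target η) : ∀ᵐ z ∂(volume.restrict φ.source),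
      fderiv ℝ (φ.source.indicator fun z => η (φ z)) z = (fderiv ℝ η (φ z)).comp (P z) := by
  filter_upwards [h.ae_hasFDerivAt, ae_restrict_mem φ.open_source.measurableSet] with z hz hzs
  have hev : (φ.source.indicator fun z => η (φ z)) =ᶠ[𝓝 z] fun z => η (φ z) := by
    filter_upwards [φ.open_source.mem_nhds hzs] with w hw
    exact indicator_of_mem hw _
  rw [hev.fderiv_eq]
  exact ((hη.differentiable (φ z)).hasFDerivAt.comp z hz).fderiv

end Pullback

/-! ### The adjugate and its weakly divergence-free columns. -/

section Inverse

/-- The adjugate of a real-linear map of the plane, by the Cayley–Hamilton theorem. -/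
def clmAdjugate (L : ℂ →L[ℝ] ℂ) : ℂ →L[ℝ] ℂ :=
  ((L 1).re + (L Complex.I).im) • ContinuousLinearMap.id ℝ ℂ - L

lemma clm_apply_eq {F : Type*} [NormedAddCommGroup F] [NormedSpace ℝ F] (L : ℂ →L[ℝ] F) (v : ℂ) :
    L v = v.re • L 1 + v.im • L Complex.I := by
  conv_lhs => rw [show v = v.re • (1 : ℂ) + v.im • Complex.I by
    simp [Complex.real_smul, Complex.re_add_im]]
  simp only [map_add, map_smul]

lemma clm_det_eq (L : ℂ →L[ℝ] ℂ) :
    L.det = (L 1).re * (L Complex.I).im - (L Complex.I).re * (L 1).im := by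
  rw [ContinuousLinearMap.det, ← LinearMap.det_toMatrix Complex.basisOneI, Matrix.det_fin_two]
  simp [LinearMap.toMatrix_apply, Complex.coe_basisOneI_repr]

lemma clm_apply_clmAdjugate (L : ℂ →L[ℝ] ℂ) (v : ℂ) : L (clmAdjugate L v) = L.det • v := by
  rw [clm_det_eq, clm_apply_eq L, clmAdjugate]
  simp only [sub_apply, smul_apply, ContinuousLinearMap.id_apply]
  rw [clm_apply_eq L v]
  apply Complex.ext <;> simp <;> ring

lemma clmAdjugate_apply_clm (L : ℂ →L[ℝ] ℂ) (v : ℂ) : clmAdjugate L (L v) = L.det • v := by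
  rw [clm_det_eq, clmAdjugate]
  simp only [sub_apply, smul_apply, ContinuousLinearMap.id_apply]
  rw [clm_apply_eq L (L v), clm_apply_eq L v]
  apply Complex.ext <;> simp <;> ring

lemma det_clmAdjugate (L : ℂ →L[ℝ] ℂ) : (clmAdjugate L).det = L.det := by
  rw [clm_det_eq, clm_det_eq, clmAdjugate]
  simp
  ring

lemma continuous_clmAdjugate : Continuous clmAdjugate := by
  unfold clmAdjugate
  fun_prop

/-- The trace contributes at most $2\|L\|$ and $L$ itself $\|L\|$. -/
lemma norm_clmAdjugate_le (L : ℂ →L[ℝ] ℂ) : ‖clmAdjugate L‖ ≤ 3 * ‖L‖ := by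
  have h1 : |(L 1).re| ≤ ‖L‖ :=
    (Complex.abs_re_le_norm _).trans (by simpa using L.le_opNorm 1)
  have h2 : |(L Complex.I).im| ≤ ‖L‖ :=
    (Complex.abs_im_le_norm _).trans (by simpa using L.le_opNorm Complex.I)
  calc ‖clmAdjugate L‖ ≤ ‖((L 1).re + (L Complex.I).im) • ContinuousLinearMap.id ℝ ℂ‖ + ‖L‖ :=
        norm_sub_le _ _
    _ ≤ |(L 1).re + (L Complex.I).im| * 1 + ‖L‖ := by
        rw [norm_smul, Real.norm_eq_abs]
        gcongr
        exact ContinuousLinearMap.norm_id_le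
    _ ≤ 3 * ‖L‖ := by linarith [abs_add_le (L 1).re (L Complex.I).im]

/-- The pairing of a covector with the columns of the adjugate is a null Lagrangian. -/
lemma clm_comp_clmAdjugate (G : ℂ →L[ℝ] ℝ) (L : ℂ →L[ℝ] ℂ) (v : ℂ) :
    G (clmAdjugate L v) =
      v.re * (G 1 • L Complex.I - G Complex.I • L 1).im -
        v.im * (G 1 • L Complex.I - G Complex.I • L 1).re := by
  rw [clm_apply_eq G, clmAdjugate]
  simp only [sub_apply, smul_apply, ContinuousLinearMap.id_apply]
  rw [clm_apply_eq L v]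
  simp
  ring

/-- Moving the derivatives off $f$ turns the two terms into integrals of $f$ against the mixed
second derivatives of $\eta$, which agree by symmetry. -/
lemma HasWeakFDerivOn.integral_fderiv_smul_sub {Ω : Set ℂ} {f : ℂ → ℂ} {D : ℂ → ℂ →L[ℝ] ℂ}
    (h : HasWeakFDerivOn Ω f D) {η : ℂ → ℝ} (hη : IsTestFunction Ω η) :
    ∫ z in Ω, (fderiv ℝ η z 1 • D z Complex.I - fderiv ℝ η z Complex.I • D z 1) = 0 := by
  have e1 := h.integral_eq _ (hη.fderiv_apply 1) Complex.I
  have e2 := h.integral_eq _ (hη.fderiv_apply Complex.I) 1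
  have hsymm : ∀ z, fderiv ℝ (fun z => fderiv ℝ η z 1) z Complex.I =
      fderiv ℝ (fun z => fderiv ℝ η z Complex.I) z 1 := by
    intro z
    have hd : DifferentiableAt ℝ (fderiv ℝ η) z :=
      (hη.1.fderiv_right (m := ∞) (by simp)).differentiable (by simp) z
    rw [fderiv_clm_apply hd (differentiableAt_const _),
      fderiv_clm_apply hd (differentiableAt_const _)]
    have hs : IsSymmSndFDerivAt ℝ η z := hη.1.contDiffAt.isSymmSndFDerivAt (by
      rw [minSmoothness_of_isRCLikeNormedField]
      exact WithTop.coe_le_coe.2 le_top)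
    simp [hs.eq Complex.I 1]
  rw [integral_sub]
  · simp only [hsymm] at e1
    rw [e1, neg_inj] at e2
    rw [e2, sub_self]
  · exact ((hη.fderiv_apply 1).integrable_smul
      (h.locInt_deriv.clm_apply_const Complex.I)).integrableOn
  · exact ((hη.fderiv_apply Complex.I).integrable_smul
      (h.locInt_deriv.clm_apply_const 1)).integrableOn

lemma HasWeakFDerivOn.integral_fderiv_clmAdjugate {Ω : Set ℂ} {f : ℂ → ℂ} {D : ℂ → ℂ →L[ℝ] ℂ}
    (h : HasWeakFDerivOn Ω f D) {η : ℂ → ℝ} (hη : IsTestFunction Ω η) (v : ℂ) :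
    ∫ z in Ω, fderiv ℝ η z (clmAdjugate (D z) v) = 0 := by
  have hint : IntegrableOn
      (fun z => fderiv ℝ η z 1 • D z Complex.I - fderiv ℝ η z Complex.I • D z 1) Ω :=
    (((hη.fderiv_apply 1).integrable_smul (h.locInt_deriv.clm_apply_const Complex.I)).sub
      ((hη.fderiv_apply Complex.I).integrable_smul
        (h.locInt_deriv.clm_apply_const 1))).integrableOn
  have := (v.re • Complex.imCLM - v.im • Complex.reCLM).integral_comp_comm hint
  rw [h.integral_fderiv_smul_sub hη, map_zero] at this
  rw [← this]
  refine integral_congr_ae (Eventually.of_forall fun z => ?_)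
  simp only [clm_comp_clmAdjugate]
  rfl

end Inverse

/-! ### The weak derivative of the inverse map. -/

section InverseDerivative

variable {φ : OpenPartialHomeomorph ℂ ℂ} {P : ℂ → ℂ →L[ℝ] ℂ}

lemma IsTestFunction.mul_clm {Ω : Set ℂ} {η : ℂ → ℝ} (hη : IsTestFunction Ω η) (L : ℂ →L[ℝ] ℝ) :
    IsTestFunction Ω (fun z => η z * L z) :=
  ⟨hη.1.mul L.contDiff, hη.2.1.mul_right,
    (tsupport_mul_subset_left (f := η) (g := fun z => L z)).trans hη.2.2⟩

lemma HasWeakFDerivOn.locallyIntegrableOn_clmAdjugate {Ω : Set ℂ} {f : ℂ → ℂ} {D : ℂ → ℂ →L[ℝ] ℂ}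
    (h : HasWeakFDerivOn Ω f D) : LocallyIntegrableOn (fun z => clmAdjugate (D z)) Ω := by
  intro z hz
  obtain ⟨s, hs, hi⟩ := h.locInt_deriv z hz
  refine ⟨s, hs, (hi.norm.const_mul 3).mono'
    (continuous_clmAdjugate.comp_aestronglyMeasurable hi.1) ?_⟩
  exact Eventually.of_forall fun w => norm_clmAdjugate_le _

lemma HasWeakFDerivOn.integral_smul_add_smul {Ω : Set ℂ} {f : ℂ → ℂ} {D : ℂ → ℂ →L[ℝ] ℂ}
    (h : HasWeakFDerivOn Ω f D) {η : ℂ → ℝ} (hη : IsTestFunction Ω η) (v : ℂ) :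
    ∫ z in Ω, (fderiv ℝ η z (clmAdjugate (D z) v) • z + η z • clmAdjugate (D z) v) = 0 := by
  have hadj := h.locallyIntegrableOn_clmAdjugate.clm_apply_const v
  have hint2 : IntegrableOn (fun z => η z • clmAdjugate (D z) v) Ω :=
    (hη.integrable_smul hadj).integrableOn
  have hcoord : LocallyIntegrableOn (fun z => (clmAdjugate (D z) v).re) Ω ∧
      LocallyIntegrableOn (fun z => (clmAdjugate (D z) v).im) Ω := by
    constructor
    · intro z hz
      obtain ⟨s, hs, hi⟩ := hadj z hz
      exact ⟨s, hs, Complex.reCLM.integrable_comp hi⟩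
    · intro z hz
      obtain ⟨s, hs, hi⟩ := hadj z hz
      exact ⟨s, hs, Complex.imCLM.integrable_comp hi⟩
  have hint1 : IntegrableOn (fun z => fderiv ℝ η z (clmAdjugate (D z) v) • z) Ω := by
    have h0 : IntegrableOn (fun z => fderiv ℝ η z (clmAdjugate (D z) v)) Ω := by
      have e : (fun z => fderiv ℝ η z (clmAdjugate (D z) v)) = fun z =>
          fderiv ℝ η z 1 • (clmAdjugate (D z) v).re +
          fderiv ℝ η z Complex.I • (clmAdjugate (D z) v).im := by
        funext z
        rw [clm_apply_eq (fderiv ℝ η z) (clmAdjugate (D z) v)]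
        simp only [smul_eq_mul]
        ring
      rw [e]
      exact (((hη.fderiv_apply 1).integrable_smul hcoord.1).add
        ((hη.fderiv_apply Complex.I).integrable_smul hcoord.2)).integrableOn
    obtain ⟨R, hR⟩ := hη.2.1.isCompact.isBounded.exists_norm_le
    refine (h0.norm.const_mul R).mono' (h0.1.smul continuous_id.aestronglyMeasurable) ?_
    refine Eventually.of_forall fun z => ?_
    rw [norm_smul, mul_comm]
    by_cases hzs : z ∈ tsupport η
    · exact mul_le_mul_of_nonneg_right (hR z hzs) (norm_nonneg _)
    · have : fderiv ℝ η z = 0 :=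
        image_eq_zero_of_notMem_tsupport fun h => hzs (tsupport_fderiv_subset ℝ h)
      simp [this]
  have key : ∀ L : ℂ →L[ℝ] ℝ, L (∫ z in Ω,
      (fderiv ℝ η z (clmAdjugate (D z) v) • z + η z • clmAdjugate (D z) v)) = 0 := by
    intro L
    have hcomm := L.integral_comp_comm (hint1.add hint2)
    simp only [Pi.add_apply] at hcomm
    -- The divergence-free identity is tested with $\eta\cdot L$; the product rule produces exactly
    -- the two terms wanted.
    rw [← hcomm, ← h.integral_fderiv_clmAdjugate (hη.mul_clm L) v]
    refine integral_congr_ae (Eventually.of_forall fun z => ?_)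
    have : HasFDerivAt (fun z => η z * L z) (η z • L + L z • fderiv ℝ η z) z :=
      (hη.differentiable z).hasFDerivAt.mul L.hasFDerivAt
    simp only [this.fderiv, map_add, map_smul, add_apply, smul_apply, smul_eq_mul]
    ring
  exact Complex.ext (key Complex.reCLM) (key Complex.imCLM)

/-- Extends the previous identity from test functions to Lipschitz $u$ by dominated convergence,
using the bound on `P`. It will be applied to $u=\eta\circ\varphi$, which need not be smooth. -/
lemma IsUnimodular.integral_smul_add_smul (h : IsUnimodular φ P) {u : ℂ → ℝ} {C : ℝ≥0}
    (hu : LipschitzWith C u) (hc : HasCompactSupport u) (hs : tsupport u ⊆ φ.source) (v : ℂ) :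
    ∫ z in φ.source, (fderiv ℝ u z (clmAdjugate (P z) v) • z + u z • clmAdjugate (P z) v) = 0 := by
  obtain ⟨K, hK, hKs, huK, η, h1, h2, h3, h4, h5, h6⟩ :=
    exists_testFunction_tendsto hu φ.open_source hc hs
  obtain ⟨M, hM⟩ := h.bound
  obtain ⟨B, hB⟩ := hc.exists_bound_of_continuous hu.continuous
  obtain ⟨R, hR⟩ := hK.isBounded.exists_norm_le
  have hPm : AEStronglyMeasurable (fun z => clmAdjugate (P z) v) (volume.restrict φ.source) :=
    (h.weak.locallyIntegrableOn_clmAdjugate.clm_apply_const v).aestronglyMeasurable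
  have hlim : Tendsto (fun n => ∫ z in φ.source,
      (fderiv ℝ (η n) z (clmAdjugate (P z) v) • z + η n z • clmAdjugate (P z) v)) atTop
      (𝓝 (∫ z in φ.source, (fderiv ℝ u z (clmAdjugate (P z) v) • z +
        u z • clmAdjugate (P z) v))) := by
    refine tendsto_integral_of_dominated_convergence
      (K.indicator fun _ => C * (3 * M * ‖v‖) * R + (C + B) * (3 * M * ‖v‖)) ?_ ?_ ?_ ?_
    · intro n
      have hm : AEStronglyMeasurable (fun z => fderiv ℝ (η n) z) (volume.restrict φ.source) :=
        (measurable_fderiv ℝ (η n)).aestronglyMeasurable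
      have happ : AEStronglyMeasurable (fun z => fderiv ℝ (η n) z (clmAdjugate (P z) v))
          (volume.restrict φ.source) :=
        (isBoundedBilinearMap_apply (𝕜 := ℝ) (E := ℂ) (F := ℝ)).continuous.comp_aestronglyMeasurable
          (hm.prodMk hPm)
      have hid : AEStronglyMeasurable (fun z : ℂ => z) (volume.restrict φ.source) :=
        continuous_id.aestronglyMeasurable
      exact (happ.smul hid).add ((h1 n).continuous.aestronglyMeasurable.smul hPm)
    · rw [integrable_indicator_iff hK.measurableSet]
      exact integrableOn_const (((Measure.restrict_apply_le _ _).trans_lt hK.measure_lt_top).ne)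
    · intro n
      filter_upwards [hM] with z hz
      have hadj : ‖clmAdjugate (P z) v‖ ≤ 3 * M * ‖v‖ := by
        refine ((clmAdjugate (P z)).le_opNorm v).trans ?_
        gcongr
        exact (norm_clmAdjugate_le _).trans (by gcongr)
      by_cases hzK : z ∈ K
      · rw [indicator_of_mem hzK]
        refine (norm_add_le _ _).trans ?_
        rw [norm_smul, norm_smul]
        have e1 : ‖fderiv ℝ (η n) z (clmAdjugate (P z) v)‖ ≤ C * (3 * M * ‖v‖) :=
          ((fderiv ℝ (η n) z).le_opNorm _).trans
            (mul_le_mul (h4 n z) hadj (norm_nonneg _) C.2)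
        have e2 : ‖η n z‖ ≤ C + B := by
          have := norm_add_le (η n z - u z) (u z)
          rw [sub_add_cancel] at this
          linarith [h3 n z, hB z]
        refine add_le_add (mul_le_mul e1 (hR z hzK) (norm_nonneg _) (by positivity))
          (mul_le_mul e2 hadj (norm_nonneg _) ((norm_nonneg _).trans e2))
      · have hz0 : z ∉ tsupport (η n) := fun h => hzK (h2 n h)
        have : fderiv ℝ (η n) z = 0 :=
          image_eq_zero_of_notMem_tsupport fun h => hz0 (tsupport_fderiv_subset ℝ h)
        rw [indicator_of_notMem hzK, this, image_eq_zero_of_notMem_tsupport hz0]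
        simp
    · filter_upwards [ae_restrict_of_ae h6] with z hz
      exact (((ContinuousLinearMap.apply ℝ ℝ (clmAdjugate (P z) v)).continuous.tendsto _).comp hz
        |>.smul_const z).add ((h5 z).smul_const _)
  have h0 : ∀ n, ∫ z in φ.source,
      (fderiv ℝ (η n) z (clmAdjugate (P z) v) • z + η n z • clmAdjugate (P z) v) = 0 :=
    fun n => h.weak.integral_smul_add_smul (h1 n) v
  simp only [h0] at hlim
  exact (tendsto_nhds_unique tendsto_const_nhds hlim).symm

/-- The inverse of a homeomorphism with bounded weak derivative of determinant `1` has the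
same property. -/
theorem IsUnimodular.symm (h : IsUnimodular φ P) :
    IsUnimodular φ.symm (fun w => clmAdjugate (P (φ.symm w))) := by
  obtain ⟨M, hM⟩ := h.bound
  have hbd : ∀ᵐ w ∂(volume.restrict φ.target), ‖clmAdjugate (P (φ.symm w))‖ ≤ 3 * M := by
    filter_upwards [h.ae_symm hM] with w hw
    exact (norm_clmAdjugate_le _).trans (by gcongr)
  refine ⟨⟨?_, ?_, ?_⟩, ⟨3 * M, by simpa using hbd⟩, ?_⟩
  · exact φ.continuousOn_symm.locallyIntegrableOn φ.open_target.measurableSet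
  · refine locallyIntegrableOn_of_locallyIntegrable_restrict
      ((memLp_top_of_bound ?_ (3 * M) hbd).locallyIntegrable le_top)
    exact h.aestronglyMeasurable_comp_symm
      (continuous_clmAdjugate.comp_aestronglyMeasurable h.weak.locInt_deriv.aestronglyMeasurable)
  · intro η hη v
    change IsTestFunction φ.target η at hη
    change ∫ w in φ.target, fderiv ℝ η w v • φ.symm w =
      -∫ w in φ.target, η w • clmAdjugate (P (φ.symm w)) v
    -- After the change of variables the inverse map becomes the coordinate $z$ itself.
    rw [← h.integral_comp, ← h.integral_comp]
    obtain ⟨hc, hs, C, hC⟩ := h.exists_lipschitzWith hη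
    obtain ⟨hc', hs', C', hC'⟩ := h.exists_lipschitzWith (hη.fderiv_apply v)
    have key := h.integral_smul_add_smul hC hc hs v
    have i1 : IntegrableOn (fun z => fderiv ℝ η (φ z) v • z) φ.source := by
      refine (integrable_smul_of_locallyIntegrableOn hC'.continuous hc' hs'
        (continuous_id.locallyIntegrable.locallyIntegrableOn _)).integrableOn.congr_fun ?_
        φ.open_source.measurableSet
      intro z hz
      simp only [indicator_of_mem hz, id]
    have i2 : IntegrableOn (fun z => η (φ z) • clmAdjugate (P z) v) φ.source := by
      refine (integrable_smul_of_locallyIntegrableOn hC.continuous hc hs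
        (h.weak.locallyIntegrableOn_clmAdjugate.clm_apply_const v)).integrableOn.congr_fun ?_
        φ.open_source.measurableSet
      intro z hz
      simp only [indicator_of_mem hz]
    -- By the chain rule
    -- $D(\eta\circ\varphi)\,\mathrm{adj}(P)v=D\eta(\varphi)\,P\,\mathrm{adj}(P)v=D\eta(\varphi)v$,
    -- since $\det P=1$.
    have e : ∫ z in φ.source, (fderiv ℝ η (φ z) v • z + η (φ z) • clmAdjugate (P z) v) = 0 := by
      rw [← key]
      refine integral_congr_ae ?_
      filter_upwards [h.fderiv_indicator_comp hη, h.det,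
        ae_restrict_mem φ.open_source.measurableSet] with z hz hd hzs
      rw [hz, indicator_of_mem hzs, ContinuousLinearMap.comp_apply, clm_apply_clmAdjugate, hd,
        one_smul]
    rw [integral_add i1 i2] at e
    rw [setIntegral_congr_fun φ.open_source.measurableSet
        (g := fun z => fderiv ℝ η (φ z) v • z) fun z hz => by
          simp only [φ.left_inv hz],
      setIntegral_congr_fun φ.open_source.measurableSet
        (f := fun z => η (φ z) • clmAdjugate (P (φ.symm (φ z))) v)
        (g := fun z => η (φ z) • clmAdjugate (P z) v) fun z hz => by
          simp only [φ.left_inv hz]]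
    exact eq_neg_of_add_eq_zero_left e
  · filter_upwards [h.ae_symm h.det] with w hw
    rw [det_clmAdjugate, hw]

end InverseDerivative

/-! ### $W^{1,2}_0$ with the weight $A$ removed. -/

section SobolevZero

/-- `f` is the `W^{1,2}(Ω)`-limit of test functions and `D` is its weak derivative. -/
structure IsSobolevZero (Ω : Set ℂ) (f : ℂ → ℝ) (D : ℂ → ℂ →L[ℝ] ℝ) : Prop where
  weak : HasWeakFDerivOn Ω f D
  memLp : MemLp f 2 (volume.restrict Ω)
  memLp_deriv : MemLp D 2 (volume.restrict Ω)
  approx : ∀ ε : ℝ≥0∞, 0 < ε → ∃ η : ℂ → ℝ, IsTestFunction Ω η ∧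
    eLpNorm (f - η) 2 (volume.restrict Ω) < ε ∧
    eLpNorm (D - fderiv ℝ η) 2 (volume.restrict Ω) < ε

/-- The bilinear form of a matrix on gradients of linear functionals. -/
def gradForm (A : Matrix (Fin 2) (Fin 2) ℝ) (p q : ℂ →L[ℝ] ℝ) : ℝ :=
  (A *ᵥ ![p 1, p Complex.I]) ⬝ᵥ ![q 1, q Complex.I]

lemma gradForm_eq (A : Matrix (Fin 2) (Fin 2) ℝ) (p q : ℂ →L[ℝ] ℝ) :
    gradForm A p q = (A 0 0 * p 1 + A 0 1 * p Complex.I) * q 1 +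
      (A 1 0 * p 1 + A 1 1 * p Complex.I) * q Complex.I := by
  simp [gradForm, Matrix.mulVec, dotProduct, Fin.sum_univ_two]

variable {A : ℂ → Matrix (Fin 2) (Fin 2) ℝ} {Ω : Set ℂ} {K : ℝ}

lemma energy_eq {f : ℂ → ℝ} {D : ℂ → ℂ →L[ℝ] ℝ} (hΩ : IsOpen Ω) (h : HasWeakFDerivOn Ω f D) :
    energy A Ω f = ∫⁻ z in Ω, ENNReal.ofReal (gradForm (A z) (D z) (D z)) := by
  refine lintegral_congr_ae ?_
  filter_upwards [h.weakFDeriv_ae_eq hΩ] with z hz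
  simp only [weakGrad, hz, gradForm]

/-- The factor $2$ is not sharp; only equivalence of the norms is used. -/
lemma norm_sq_le (p : ℂ →L[ℝ] ℝ) : ‖p‖ ^ 2 ≤ 2 * (p 1 ^ 2 + p Complex.I ^ 2) := by
  have h : ‖p‖ ≤ |p 1| + |p Complex.I| := by
    refine p.opNorm_le_bound (by positivity) fun v => ?_
    rw [clm_apply_eq p v, smul_eq_mul, smul_eq_mul, Real.norm_eq_abs]
    refine (abs_add_le _ _).trans ?_
    rw [abs_mul, abs_mul]
    nlinarith [Complex.abs_re_le_norm v, Complex.abs_im_le_norm v, abs_nonneg (p 1),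
      abs_nonneg (p Complex.I)]
  calc ‖p‖ ^ 2 ≤ (|p 1| + |p Complex.I|) ^ 2 := by gcongr
    _ ≤ 2 * (p 1 ^ 2 + p Complex.I ^ 2) := by
      nlinarith [sq_nonneg (|p 1| - |p Complex.I|), sq_abs (p 1), sq_abs (p Complex.I)]

lemma le_norm_sq (p : ℂ →L[ℝ] ℝ) : p 1 ^ 2 + p Complex.I ^ 2 ≤ 2 * ‖p‖ ^ 2 := by
  have h1 : |p 1| ≤ ‖p‖ := by simpa using p.le_opNorm 1
  have h2 : |p Complex.I| ≤ ‖p‖ := by simpa using p.le_opNorm Complex.I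
  rw [← sq_abs (p 1), ← sq_abs (p Complex.I)]
  nlinarith [abs_nonneg (p 1), abs_nonneg (p Complex.I)]

lemma IsElliptic.gradForm_bounds (hK : 1 ≤ K) (hA : IsElliptic K A Ω) :
    ∀ᵐ z ∂(volume.restrict Ω), ∀ p : ℂ →L[ℝ] ℝ,
      gradForm (A z) p p ≤ 2 * K * ‖p‖ ^ 2 ∧ ‖p‖ ^ 2 ≤ 2 * K * gradForm (A z) p p := by
  filter_upwards [hA] with z hz p
  obtain ⟨h1, h2⟩ := hz ![p 1, p Complex.I]
  have e : ![p 1, p Complex.I] ⬝ᵥ ![p 1, p Complex.I] = p 1 ^ 2 + p Complex.I ^ 2 := by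
    simp [dotProduct, Fin.sum_univ_two, sq]
  rw [e] at h1 h2
  have hK0 : 0 < K := by linarith
  constructor
  · calc gradForm (A z) p p ≤ K * (p 1 ^ 2 + p Complex.I ^ 2) := h2
      _ ≤ K * (2 * ‖p‖ ^ 2) := by gcongr; exact le_norm_sq p
      _ = _ := by ring
  · have h3 : p 1 ^ 2 + p Complex.I ^ 2 ≤ K * gradForm (A z) p p := by
      rw [one_div, inv_mul_le_iff₀ hK0] at h1
      exact h1
    calc ‖p‖ ^ 2 ≤ 2 * (p 1 ^ 2 + p Complex.I ^ 2) := norm_sq_le p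
      _ ≤ 2 * (K * gradForm (A z) p p) := by gcongr
      _ = _ := by ring

lemma eLpNorm_two_eq {E : Type*} [NormedAddCommGroup E] (f : ℂ → E) (μ : Measure ℂ) :
    eLpNorm f 2 μ = (∫⁻ z, ENNReal.ofReal (‖f z‖ ^ 2) ∂μ) ^ (1 / 2 : ℝ) := by
  rw [eLpNorm_eq_lintegral_rpow_enorm_toReal (by norm_num) (by norm_num)]
  simp [ENNReal.ofReal_pow]

lemma rpow_half_lintegral_le {μ : Measure ℂ} {a b : ℂ → ℝ} {C : ℝ} (hC : 0 ≤ C)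
    (h : ∀ᵐ z ∂μ, a z ≤ C * b z) :
    (∫⁻ z, ENNReal.ofReal (a z) ∂μ) ^ (1 / 2 : ℝ) ≤
      ENNReal.ofReal C ^ (1 / 2 : ℝ) * (∫⁻ z, ENNReal.ofReal (b z) ∂μ) ^ (1 / 2 : ℝ) := by
  rw [← ENNReal.mul_rpow_of_nonneg _ _ (by norm_num),
    ← lintegral_const_mul' _ _ ENNReal.ofReal_ne_top]
  refine ENNReal.rpow_le_rpow (lintegral_mono_ae ?_) (by norm_num)
  filter_upwards [h] with z hz
  rw [← ENNReal.ofReal_mul hC]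
  exact ENNReal.ofReal_le_ofReal hz

lemma IsElliptic.energy_le (hK : 1 ≤ K) (hA : IsElliptic K A Ω) (hΩ : IsOpen Ω) {f : ℂ → ℝ}
    {D : ℂ → ℂ →L[ℝ] ℝ} (h : HasWeakFDerivOn Ω f D) :
    energy A Ω f ^ (1 / 2 : ℝ) ≤
      ENNReal.ofReal (2 * K) ^ (1 / 2 : ℝ) * eLpNorm D 2 (volume.restrict Ω) := by
  rw [energy_eq hΩ h, eLpNorm_two_eq]
  refine rpow_half_lintegral_le (by linarith) ?_
  filter_upwards [hA.gradForm_bounds hK] with z hz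
  exact (hz _).1

lemma IsElliptic.le_energy (hK : 1 ≤ K) (hA : IsElliptic K A Ω) (hΩ : IsOpen Ω) {f : ℂ → ℝ}
    {D : ℂ → ℂ →L[ℝ] ℝ} (h : HasWeakFDerivOn Ω f D) :
    eLpNorm D 2 (volume.restrict Ω) ≤
      ENNReal.ofReal (2 * K) ^ (1 / 2 : ℝ) * energy A Ω f ^ (1 / 2 : ℝ) := by
  rw [energy_eq hΩ h, eLpNorm_two_eq]
  refine rpow_half_lintegral_le (by linarith) ?_
  filter_upwards [hA.gradForm_bounds hK] with z hz
  exact (hz _).2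

lemma IsTestFunction.hasWeakFDerivOn {η : ℂ → ℝ} (hη : IsTestFunction Ω η) :
    HasWeakFDerivOn Ω η (fderiv ℝ η) :=
  let ⟨_, hC⟩ := hη.1.lipschitzWith_of_hasCompactSupport hη.2.1 (by simp)
  hasWeakFDerivOn_of_lipschitzWith hC Ω

lemma IsTestFunction.memLp {η : ℂ → ℝ} (hη : IsTestFunction Ω η) :
    MemLp η 2 (volume.restrict Ω) :=
  (hη.continuous.memLp_of_hasCompactSupport hη.2.1).mono_measure Measure.restrict_le_self

lemma IsTestFunction.memLp_fderiv {η : ℂ → ℝ} (hη : IsTestFunction Ω η) :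
    MemLp (fderiv ℝ η) 2 (volume.restrict Ω) :=
  ((hη.1.continuous_fderiv (by simp)).memLp_of_hasCompactSupport (hη.2.1.fderiv (𝕜 := ℝ))
    ).mono_measure Measure.restrict_le_self

lemma ofReal_rpow_half_ne_top (K : ℝ) : ENNReal.ofReal K ^ (1 / 2 : ℝ) ≠ ⊤ :=
  ENNReal.rpow_ne_top_of_nonneg (by norm_num) ENNReal.ofReal_ne_top

lemma exists_mul_lt {c : ℝ≥0∞} (hc : c ≠ ⊤) {ε : ℝ≥0∞} (hε : 0 < ε) :
    ∃ δ : ℝ≥0∞, 0 < δ ∧ δ + c * δ < ε := by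
  obtain ⟨ε', h0, h1⟩ := exists_between hε
  have hne : ε' ≠ ⊤ := h1.ne_top
  have hc1 : 1 + c ≠ ⊤ := ENNReal.add_ne_top.2 ⟨by simp, hc⟩
  refine ⟨ε' / (1 + c), ENNReal.div_pos h0.ne' hc1, ?_⟩
  have : ε' / (1 + c) + c * (ε' / (1 + c)) = (1 + c) * (ε' / (1 + c)) := by rw [add_mul, one_mul]
  rw [this, ENNReal.mul_div_cancel (by simp) hc1]
  exact h1

/-- Ellipticity makes the energy seminorm equivalent to the $L^2$ norm of the weak derivative. With
the converse below, membership in $W^{1,2}_0$ can be transported without reference to the matrix. -/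
lemma MemSobolevZero.isSobolevZero {f : ℂ → ℝ} (h : MemSobolevZero A Ω f) (hΩ : IsOpen Ω)
    (hK : 1 ≤ K) (hA : IsElliptic K A Ω) : IsSobolevZero Ω f (weakFDeriv Ω f) := by
  obtain ⟨⟨hw, hn⟩, happ⟩ := h
  have hweak := hw.hasWeakFDerivOn
  have hn1 := (le_self_add).trans_lt hn
  have hn2 := (le_add_self).trans_lt hn
  refine ⟨hweak, ⟨hweak.locInt.aestronglyMeasurable, hn1⟩,
    ⟨hweak.locInt_deriv.aestronglyMeasurable, (hA.le_energy hK hΩ hweak).trans_lt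
      (ENNReal.mul_lt_top (ofReal_rpow_half_ne_top _).lt_top hn2)⟩, fun ε hε => ?_⟩
  obtain ⟨δ, hδ, hδε⟩ := exists_mul_lt (ofReal_rpow_half_ne_top (2 * K)) hε
  obtain ⟨η, hη, hηδ⟩ := happ δ hδ
  refine ⟨η, hη, ((le_self_add).trans hηδ.le).trans_lt ((le_self_add).trans_lt hδε), ?_⟩
  refine (hA.le_energy hK hΩ (hweak.sub hη.hasWeakFDerivOn)).trans_lt ?_
  refine lt_of_le_of_lt ?_ (le_add_self.trans_lt hδε)
  gcongr
  exact le_add_self.trans hηδ.le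

lemma IsSobolevZero.memSobolevZero {f : ℂ → ℝ} {D : ℂ → ℂ →L[ℝ] ℝ} (h : IsSobolevZero Ω f D)
    (hΩ : IsOpen Ω) (hK : 1 ≤ K) (hA : IsElliptic K A Ω) : MemSobolevZero A Ω f := by
  refine ⟨⟨⟨D, h.weak⟩, ENNReal.add_lt_top.2 ⟨h.memLp.2, (hA.energy_le hK hΩ h.weak).trans_lt
    (ENNReal.mul_lt_top (ofReal_rpow_half_ne_top _).lt_top h.memLp_deriv.2)⟩⟩, fun ε hε => ?_⟩
  obtain ⟨δ, hδ, hδε⟩ := exists_mul_lt (ofReal_rpow_half_ne_top (2 * K)) hε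
  obtain ⟨η, hη, h1, h2⟩ := h.approx δ hδ
  refine ⟨η, hη, lt_of_le_of_lt (add_le_add h1.le
    ((hA.energy_le hK hΩ (h.weak.sub hη.hasWeakFDerivOn)).trans ?_)) hδε⟩
  gcongr

end SobolevZero

/-! ### Composition operators on $W^{1,2}_0$. -/

section Pullback

variable {φ : OpenPartialHomeomorph ℂ ℂ} {P : ℂ → ℂ →L[ℝ] ℂ}

lemma IsUnimodular.aestronglyMeasurable_comp {F : Type*} [NormedAddCommGroup F]
    (h : IsUnimodular φ P) {g : ℂ → F} (hg : AEStronglyMeasurable g (volume.restrict φ.target)) :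
    AEStronglyMeasurable (fun z => g (φ z)) (volume.restrict φ.source) := by
  simpa using h.symm.aestronglyMeasurable_comp_symm (g := g) (by simpa using hg)

lemma IsUnimodular.eLpNorm_comp {F : Type*} [NormedAddCommGroup F] (h : IsUnimodular φ P)
    (g : ℂ → F) :
    eLpNorm (fun z => g (φ z)) 2 (volume.restrict φ.source) =
      eLpNorm g 2 (volume.restrict φ.target) := by
  rw [eLpNorm_two_eq, eLpNorm_two_eq, h.lintegral_comp fun w => ENNReal.ofReal (‖g w‖ ^ 2)]

lemma IsUnimodular.memLp_comp {F : Type*} [NormedAddCommGroup F] (h : IsUnimodular φ P)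
    {g : ℂ → F} (hg : MemLp g 2 (volume.restrict φ.target)) :
    MemLp (fun z => g (φ z)) 2 (volume.restrict φ.source) :=
  ⟨h.aestronglyMeasurable_comp hg.1, by rw [h.eLpNorm_comp]; exact hg.2⟩

lemma IsUnimodular.exists_eLpNorm_comp_le (h : IsUnimodular φ P) :
    ∃ c : ℝ≥0∞, c ≠ ⊤ ∧ ∀ D : ℂ → ℂ →L[ℝ] ℝ,
      eLpNorm (fun z => (D (φ z)).comp (P z)) 2 (volume.restrict φ.source) ≤
        c * eLpNorm D 2 (volume.restrict φ.target) := by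
  obtain ⟨M, hM⟩ := h.bound
  refine ⟨ENNReal.ofReal M, ENNReal.ofReal_ne_top, fun D => ?_⟩
  rw [← h.eLpNorm_comp D]
  refine eLpNorm_le_mul_eLpNorm_of_ae_le_mul ?_ 2
  filter_upwards [hM] with z hz
  rw [mul_comm]
  exact ((D (φ z)).opNorm_comp_le (P z)).trans (by gcongr)

lemma IsUnimodular.memLp_comp_deriv (h : IsUnimodular φ P) {D : ℂ → ℂ →L[ℝ] ℝ}
    (hD : MemLp D 2 (volume.restrict φ.target)) :
    MemLp (fun z => (D (φ z)).comp (P z)) 2 (volume.restrict φ.source) := by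
  obtain ⟨c, hc, hle⟩ := h.exists_eLpNorm_comp_le
  refine ⟨?_, (hle D).trans_lt (ENNReal.mul_lt_top hc.lt_top hD.2)⟩
  have h1 := h.aestronglyMeasurable_comp hD.1
  have h2 := h.weak.locInt_deriv.aestronglyMeasurable
  exact (isBoundedBilinearMap_comp (𝕜 := ℝ) (E := ℂ) (F := ℂ) (G := ℝ)).continuous
    |>.comp_aestronglyMeasurable (h1.prodMk h2)

lemma IsUnimodular.hasWeakFDerivOn_comp_testFunction (h : IsUnimodular φ P) {η : ℂ → ℝ}
    (hη : IsTestFunction φ.target η) :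
    HasWeakFDerivOn φ.source (fun z => η (φ z)) (fun z => (fderiv ℝ η (φ z)).comp (P z)) := by
  obtain ⟨-, -, C, hC⟩ := h.exists_lipschitzWith hη
  refine (hasWeakFDerivOn_of_lipschitzWith hC φ.source).congr ?_ (h.fderiv_indicator_comp hη)
  filter_upwards [ae_restrict_mem φ.open_source.measurableSet] with z hz
  exact indicator_of_mem hz _

/-- Composition with a unimodular homeomorphism preserves `W₀^{1,2}`, with the chain rule. -/
theorem IsUnimodular.isSobolevZero_comp (h : IsUnimodular φ P) {f : ℂ → ℝ} {D : ℂ → ℂ →L[ℝ] ℝ}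
    (hf : IsSobolevZero φ.target f D) :
    IsSobolevZero φ.source (fun z => f (φ z)) (fun z => (D (φ z)).comp (P z)) := by
  obtain ⟨c, hc, hle⟩ := h.exists_eLpNorm_comp_le
  refine ⟨?_, h.memLp_comp hf.memLp, h.memLp_comp_deriv hf.memLp_deriv, fun ε hε => ?_⟩
  · have hpos : ∀ n : ℕ, (0 : ℝ≥0∞) < ((n : ℝ≥0∞) + 1)⁻¹ := fun n => by
      simp [ENNReal.add_eq_top]
    choose η hη h1 h2 using fun n : ℕ => hf.approx _ (hpos n)
    have hlim0 : Tendsto (fun n : ℕ => ((n : ℝ≥0∞) + 1)⁻¹) atTop (𝓝 0) := by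
      have := ENNReal.tendsto_inv_nat_nhds_zero.comp (tendsto_add_atTop_nat 1)
      simpa [Function.comp_def] using this
    refine HasWeakFDerivOn.of_tendsto (fun n => h.hasWeakFDerivOn_comp_testFunction (hη n))
      (fun n => h.memLp_comp (hη n).memLp) (fun n => h.memLp_comp_deriv (hη n).memLp_fderiv)
      (h.memLp_comp hf.memLp) (h.memLp_comp_deriv hf.memLp_deriv) ?_ ?_
    · refine tendsto_of_tendsto_of_tendsto_of_le_of_le tendsto_const_nhds hlim0
        (fun _ => zero_le) fun n => ?_
      rw [eLpNorm_sub_comm]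
      exact (h.eLpNorm_comp (f - η n)).trans_le (h1 n).le
    · have hlim1 := ENNReal.Tendsto.const_mul hlim0 (Or.inr hc)
      rw [mul_zero] at hlim1
      refine tendsto_of_tendsto_of_tendsto_of_le_of_le tendsto_const_nhds hlim1
        (fun _ => zero_le) fun n => ?_
      rw [eLpNorm_sub_comm]
      refine le_trans (le_of_eq ?_) ((hle (D - fderiv ℝ (η n))).trans
        (mul_le_mul_right (h2 n).le c))
      congr 1
  · obtain ⟨δ, hδ, hδε⟩ := exists_mul_lt (ENNReal.add_ne_top.2 ⟨hc, ENNReal.one_ne_top⟩) hε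
    obtain ⟨η, hη, h1, h2⟩ := hf.approx δ hδ
    obtain ⟨hcs, hss, C, hC⟩ := h.exists_lipschitzWith hη
    -- A second approximation is needed because the pulled-back test function is merely Lipschitz;
    -- the constant `c + 1` above leaves room for both errors.
    obtain ⟨ζ, hζ, h3, h4⟩ := exists_testFunction_eLpNorm_tendsto hC φ.open_source hcs hss
    obtain ⟨n, hn3, hn4⟩ := ((h3.eventually_lt_const hδ).and (h4.eventually_lt_const hδ)).exists
    set u := φ.source.indicator fun z => η (φ z) with hu
    have hsum : δ + δ ≤ δ + (c + 1) * δ := by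
      gcongr
      exact le_mul_of_one_le_left zero_le le_add_self
    have hsum' : c * δ + δ ≤ δ + (c + 1) * δ := by
      rw [add_mul, one_mul]
      exact le_add_self
    have hue : u =ᵐ[volume.restrict φ.source] fun z => η (φ z) := by
      filter_upwards [ae_restrict_mem φ.open_source.measurableSet] with z hz
      exact indicator_of_mem hz _
    refine ⟨ζ n, hζ n, ?_, ?_⟩
    · have e : (fun z => f (φ z)) - ζ n = ((fun z => f (φ z)) - u) + (u - ζ n) := by abel
      rw [e]
      refine (eLpNorm_add_le ((h.memLp_comp hf.memLp).1.sub
        hC.continuous.aestronglyMeasurable)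
        (hC.continuous.sub (hζ n).continuous).aestronglyMeasurable (by norm_num)).trans_lt ?_
      refine lt_of_le_of_lt ((add_le_add ?_ ?_).trans hsum) hδε
      · rw [eLpNorm_congr_ae ((ae_eq_refl fun z => f (φ z)).sub hue)]
        exact (h.eLpNorm_comp (f - η)).trans_le h1.le
      · exact (eLpNorm_mono_measure _ Measure.restrict_le_self).trans hn3.le
    · have e : (fun z => (D (φ z)).comp (P z)) - fderiv ℝ (ζ n) =
          ((fun z => (D (φ z)).comp (P z)) - fderiv ℝ u) + (fderiv ℝ u - fderiv ℝ (ζ n)) := by abel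
      rw [e]
      refine (eLpNorm_add_le ((h.memLp_comp_deriv hf.memLp_deriv).1.sub
        (measurable_fderiv ℝ u).aestronglyMeasurable)
        ((measurable_fderiv ℝ u).sub (measurable_fderiv ℝ (ζ n))).aestronglyMeasurable
        (by norm_num)).trans_lt ?_
      refine lt_of_le_of_lt ((add_le_add ?_ ?_).trans hsum') hδε
      · rw [eLpNorm_congr_ae ((ae_eq_refl _).sub (h.fderiv_indicator_comp hη))]
        refine le_trans (le_of_eq ?_) ((hle (D - fderiv ℝ η)).trans (mul_le_mul_right h2.le c))
        congr 1
      · exact (eLpNorm_mono_measure _ Measure.restrict_le_self).trans hn4.le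

end Pullback

/-! ### Invariance and nonnegativity of eigenvalues. -/

section Spectrum

/-- A unimodular homeomorphism transforming the quadratic form of `B` into that of `A`, where `A`
and `B` are elliptic. -/
structure IsFormPreserving (A B : ℂ → Matrix (Fin 2) (Fin 2) ℝ) (φ : OpenPartialHomeomorph ℂ ℂ)
    (P : ℂ → ℂ →L[ℝ] ℂ) : Prop extends IsUnimodular φ P where
  elliptic_source : ∃ K : ℝ, 1 ≤ K ∧ IsElliptic K A φ.source
  elliptic_target : ∃ K : ℝ, 1 ≤ K ∧ IsElliptic K B φ.target
  form_eq : ∀ᵐ z ∂(volume.restrict φ.source), ∀ p q : ℂ →L[ℝ] ℝ,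
    gradForm (A z) (p.comp (P z)) (q.comp (P z)) = gradForm (B (φ z)) p q

variable {A B : ℂ → Matrix (Fin 2) (Fin 2) ℝ} {φ : OpenPartialHomeomorph ℂ ℂ}
  {P : ℂ → ℂ →L[ℝ] ℂ}

/-- The form identity is inverted by cancelling $\mathrm{adj}(P)\,P=\mathrm{id}$. This symmetry
turns each one-sided inclusion below into an equality. -/
lemma IsFormPreserving.symm (h : IsFormPreserving A B φ P) :
    IsFormPreserving B A φ.symm (fun w => clmAdjugate (P (φ.symm w))) where
  toIsUnimodular := h.toIsUnimodular.symm
  elliptic_source := h.elliptic_target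
  elliptic_target := by simpa using h.elliptic_source
  form_eq := by
    change ∀ᵐ w ∂(volume.restrict φ.target), _
    filter_upwards [h.ae_symm h.form_eq, h.ae_symm h.det,
      ae_restrict_mem φ.open_target.measurableSet] with w hw hd hwt p q
    rw [φ.right_inv hwt] at hw
    have e : ∀ p : ℂ →L[ℝ] ℝ,
        (p.comp (clmAdjugate (P (φ.symm w)))).comp (P (φ.symm w)) = p := fun p => by
      ext v
      simp only [ContinuousLinearMap.comp_apply, clmAdjugate_apply_clm, hd, one_smul]
    rw [← hw, e, e]

lemma IsFormPreserving.memSobolevZero_comp (h : IsFormPreserving A B φ P) {f : ℂ → ℝ}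
    (hf : MemSobolevZero B φ.target f) :
    MemSobolevZero A φ.source (fun z => f (φ z)) ∧
      weakFDeriv φ.source (fun z => f (φ z)) =ᵐ[volume.restrict φ.source]
        fun z => (weakFDeriv φ.target f (φ z)).comp (P z) := by
  obtain ⟨K, hK, hA⟩ := h.elliptic_source
  obtain ⟨K', hK', hB⟩ := h.elliptic_target
  have hs := h.isSobolevZero_comp (hf.isSobolevZero φ.open_target hK' hB)
  exact ⟨hs.memSobolevZero φ.open_source hK hA, hs.weak.weakFDeriv_ae_eq φ.open_source⟩

lemma IsFormPreserving.memSobolevZeroNonzero_comp (h : IsFormPreserving A B φ P) {f : ℂ → ℝ}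
    (hf : MemSobolevZeroNonzero B φ.target f) :
    MemSobolevZeroNonzero A φ.source (fun z => f (φ z)) := by
  refine ⟨(h.memSobolevZero_comp hf.1).1, fun h0 => hf.2 ?_⟩
  filter_upwards [h.ae_symm h0, ae_restrict_mem φ.open_target.measurableSet] with w hw hwt
  simpa [φ.right_inv hwt] using hw

lemma IsFormPreserving.energy_comp (h : IsFormPreserving A B φ P) {f : ℂ → ℝ}
    (hf : MemSobolevZero B φ.target f) :
    energy A φ.source (fun z => f (φ z)) = energy B φ.target f := by
  rw [energy_eq φ.open_target hf.1.1.hasWeakFDerivOn,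
    energy_eq φ.open_source (h.memSobolevZero_comp hf).1.1.1.hasWeakFDerivOn,
    ← h.lintegral_comp]
  refine lintegral_congr_ae ?_
  filter_upwards [h.form_eq, (h.memSobolevZero_comp hf).2] with z hz hD
  rw [hD, hz]

lemma IsFormPreserving.integral_form_comp (h : IsFormPreserving A B φ P) {f g : ℂ → ℝ}
    (hf : MemSobolevZero B φ.target f) (hg : MemSobolevZero B φ.target g) :
    ∫ z in φ.source, (A z *ᵥ weakGrad φ.source (fun z => f (φ z)) z) ⬝ᵥ
        weakGrad φ.source (fun z => g (φ z)) z =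
      ∫ w in φ.target, (B w *ᵥ weakGrad φ.target f w) ⬝ᵥ weakGrad φ.target g w := by
  rw [← h.integral_comp]
  refine integral_congr_ae ?_
  filter_upwards [h.form_eq, (h.memSobolevZero_comp hf).2, (h.memSobolevZero_comp hg).2]
    with z hz hDf hDg
  change gradForm (A z) (weakFDeriv φ.source (fun z => f (φ z)) z)
      (weakFDeriv φ.source (fun z => g (φ z)) z) =
    gradForm (B (φ z)) (weakFDeriv φ.target f (φ z)) (weakFDeriv φ.target g (φ z))
  rw [hDf, hDg, hz]

lemma weakGrad_congr {Ω : Set ℂ} (hΩ : IsOpen Ω) {f g : ℂ → ℝ} (hf : WeaklyDifferentiableOn Ω f)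
    (hfg : f =ᵐ[volume.restrict Ω] g) : weakGrad Ω f =ᵐ[volume.restrict Ω] weakGrad Ω g := by
  have := (hf.hasWeakFDerivOn.congr hfg (ae_eq_refl _)).weakFDeriv_ae_eq hΩ
  filter_upwards [this] with z hz
  simp only [weakGrad, hz]

lemma IsFormPreserving.rayleighQuotients_subset (h : IsFormPreserving A B φ P) :
    {r : ℝ | ∃ f : ℂ → ℝ, MemSobolevZeroNonzero B φ.target f ∧
      r = (energy B φ.target f).toReal / ∫ z in φ.target, f z ^ 2} ⊆
    {r : ℝ | ∃ f : ℂ → ℝ, MemSobolevZeroNonzero A φ.source f ∧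
      r = (energy A φ.source f).toReal / ∫ z in φ.source, f z ^ 2} := by
  rintro r ⟨f, hf, rfl⟩
  refine ⟨fun z => f (φ z), h.memSobolevZeroNonzero_comp hf, ?_⟩
  rw [h.energy_comp hf.1, h.integral_comp fun w => f w ^ 2]

/-- The eigenfunction is pulled back by $\varphi$, while an arbitrary competitor $g$ on the source
is first carried to the target by $\varphi^{-1}$, so both directions of the composition theorem are
used. -/
lemma IsFormPreserving.dirichletEigenvalues_subset (h : IsFormPreserving A B φ P) :
    dirichletEigenvalues B φ.target ⊆ dirichletEigenvalues A φ.source := by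
  rintro l ⟨f, hf, hl⟩
  refine ⟨fun z => f (φ z), h.memSobolevZeroNonzero_comp hf, fun g hg => ?_⟩
  have hg' : MemSobolevZero B φ.target (fun w => g (φ.symm w)) :=
    (h.symm.memSobolevZero_comp (f := g) (by simpa using hg)).1
  have hgg : (fun z => g (φ.symm (φ z))) =ᵐ[volume.restrict φ.source] g := by
    filter_upwards [ae_restrict_mem φ.open_source.measurableSet] with z hz
    rw [φ.left_inv hz]
  have hgrad := weakGrad_congr φ.open_source (h.memSobolevZero_comp hg').1.1.1 hgg
  have e1 : ∫ z in φ.source, (A z *ᵥ weakGrad φ.source (fun z => f (φ z)) z) ⬝ᵥ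
      weakGrad φ.source g z = ∫ z in φ.source, (A z *ᵥ weakGrad φ.source (fun z => f (φ z)) z) ⬝ᵥ
      weakGrad φ.source (fun z => g (φ.symm (φ z))) z := by
    refine integral_congr_ae ?_
    filter_upwards [hgrad] with z hz
    rw [hz]
  have e2 : ∫ z in φ.source, f (φ z) * g z = ∫ z in φ.source, f (φ z) * g (φ.symm (φ z)) := by
    refine integral_congr_ae ?_
    filter_upwards [hgg] with z hz
    rw [hz]
  rw [e1, e2, h.integral_form_comp hf.1 hg', h.integral_comp fun w => f w * g (φ.symm w)]
  exact hl _ hg'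

/-- The first eigenvalue is invariant under form-preserving homeomorphisms. -/
theorem IsFormPreserving.firstEigenvalue_eq (h : IsFormPreserving A B φ P) :
    firstEigenvalue A φ.source = firstEigenvalue B φ.target := by
  have h1 := h.symm.rayleighQuotients_subset
  simp only [OpenPartialHomeomorph.symm_target, OpenPartialHomeomorph.symm_source] at h1
  exact congrArg sInf (h1.antisymm h.rayleighQuotients_subset)

/-- The weak eigenvalues are invariant under form-preserving homeomorphisms. -/
theorem IsFormPreserving.dirichletEigenvalues_eq (h : IsFormPreserving A B φ P) :
    dirichletEigenvalues A φ.source = dirichletEigenvalues B φ.target := by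
  have h1 := h.symm.dirichletEigenvalues_subset
  simp only [OpenPartialHomeomorph.symm_target, OpenPartialHomeomorph.symm_source] at h1
  exact h1.antisymm h.dirichletEigenvalues_subset

lemma firstEigenvalue_nonneg (A : ℂ → Matrix (Fin 2) (Fin 2) ℝ) (Ω : Set ℂ) :
    0 ≤ firstEigenvalue A Ω := by
  refine Real.sInf_nonneg ?_
  rintro r ⟨f, -, rfl⟩
  exact div_nonneg ENNReal.toReal_nonneg (integral_nonneg fun z => sq_nonneg _)

/-- The weak equation is tested with the eigenfunction itself. -/
lemma dirichletEigenvalue_nonneg {A : ℂ → Matrix (Fin 2) (Fin 2) ℝ} {Ω : Set ℂ} {K : ℝ}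
    (hK : 1 ≤ K) (hA : IsElliptic K A Ω) {l : ℝ} (hl : l ∈ dirichletEigenvalues A Ω) : 0 ≤ l := by
  obtain ⟨f, hf, h⟩ := hl
  have h1 := h f hf.1
  have h2 : 0 ≤ ∫ z in Ω, (A z *ᵥ weakGrad Ω f z) ⬝ᵥ weakGrad Ω f z := by
    refine integral_nonneg_of_ae ?_
    filter_upwards [hA] with z hz
    refine le_trans ?_ (hz (weakGrad Ω f z)).1
    have : 0 ≤ weakGrad Ω f z ⬝ᵥ weakGrad Ω f z :=
      Finset.sum_nonneg fun i _ => mul_self_nonneg _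
    positivity
  have hmem : MemLp f 2 (volume.restrict Ω) :=
    ⟨hf.1.1.1.hasWeakFDerivOn.locInt.aestronglyMeasurable, le_self_add.trans_lt hf.1.1.2⟩
  have h3 : 0 < ∫ z in Ω, f z * f z := by
    refine lt_of_le_of_ne (integral_nonneg fun z => mul_self_nonneg _) fun h0 => hf.2 ?_
    have := (integral_eq_zero_iff_of_nonneg (fun z => mul_self_nonneg (f z))
      (hmem.integrable_mul hmem)).1 h0.symm
    filter_upwards [this] with z hz
    exact mul_self_eq_zero.1 hz
  rw [h1] at h2
  exact nonneg_of_mul_nonneg_left h2 h3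

end Spectrum

/-! ### The complex dilatation and the algebra of the Beltrami equation. -/

section Beltrami

variable {A : ℂ → Matrix (Fin 2) (Fin 2) ℝ}

lemma isElliptic_one (Ω : Set ℂ) : IsElliptic 1 (fun _ => 1) Ω :=
  Eventually.of_forall fun z ξ => by simp

lemma det_one_add (M : Matrix (Fin 2) (Fin 2) ℝ) (hd : M.det = 1) :
    (1 + M).det = M 0 0 + M 1 1 + 2 := by
  rw [Matrix.det_fin_two] at hd ⊢
  simp
  linarith

/-- The elementary bounds on the entries of an elliptic symmetric matrix of determinant `1`. -/
lemma trace_bounds {M : Matrix (Fin 2) (Fin 2) ℝ} {K : ℝ} (hK : 1 ≤ K)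
    (he : ∀ ξ : Fin 2 → ℝ, 1 / K * (ξ ⬝ᵥ ξ) ≤ (M *ᵥ ξ) ⬝ᵥ ξ ∧ (M *ᵥ ξ) ⬝ᵥ ξ ≤ K * (ξ ⬝ᵥ ξ)) :
    0 < M 0 0 + M 1 1 ∧ M 0 0 + M 1 1 ≤ 2 * K := by
  obtain ⟨h1, h2⟩ := he ![1, 0]
  obtain ⟨h3, h4⟩ := he ![0, 1]
  simp [Matrix.mulVec, dotProduct, Fin.sum_univ_two] at h1 h2 h3 h4
  have : 0 < K⁻¹ := by positivity
  constructor <;> linarith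

/-- With $T=\operatorname{tr}A$ and $\det A=1$, the numerator has squared modulus $T^2-4$ and the
denominator is $T+2$. -/
lemma normSq_complexDilatation {z : ℂ} (hs : (A z).IsSymm) (hd : (A z).det = 1)
    (hT : 0 < A z 0 0 + A z 1 1) :
    ‖complexDilatation A z‖ ^ 2 = 1 - 4 / (A z 0 0 + A z 1 1 + 2) := by
  have h01 : A z 1 0 = A z 0 1 := hs.apply 0 1
  rw [complexDilatation, det_one_add _ hd, norm_div, div_pow, ← Complex.normSq_eq_norm_sq,
    Complex.norm_real, Real.norm_eq_abs, sq_abs]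
  rw [Matrix.det_fin_two, h01] at hd
  have : Complex.normSq (((A z 1 1 - A z 0 0 : ℝ) : ℂ) - 2 * Complex.I * ((A z 0 1 : ℝ) : ℂ)) =
      (A z 0 0 + A z 1 1 + 2) * (A z 0 0 + A z 1 1 - 2) := by
    rw [Complex.normSq_apply]
    simp
    linear_combination (-4) * hd
  rw [this]
  field_simp
  ring

/-- The bound $\operatorname{tr}A\le2K$ gives $|\mu|^2\le(K-1)/(K+1)$. The resulting strict
inequality $\|\mu\|_\infty<1$ makes the denominator positive. -/
lemma one_le_qcCoefficient {Ω : Set ℂ} (hA : MatrixClass A Ω) : 1 ≤ qcCoefficient A Ω := by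
  obtain ⟨K, hK, he⟩ := hA.elliptic
  set k := √((K - 1) / (K + 1))
  have hk : k < 1 := by
    rw [Real.sqrt_lt' one_pos, one_pow, div_lt_one (by linarith)]
    linarith
  have hbound : ∀ᵐ z ∂(volume.restrict Ω), ‖complexDilatation A z‖ ≤ k := by
    filter_upwards [hA.symm, hA.det_eq_one, he] with z hs hd hz
    obtain ⟨h1, h2⟩ := trace_bounds hK hz
    refine Real.le_sqrt_of_sq_le ?_
    rw [normSq_complexDilatation hs hd h1]
    have h3 : 4 / (2 * K + 2) ≤ 4 / (A z 0 0 + A z 1 1 + 2) := by gcongr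
    have h4 : (K - 1) / (K + 1) = 1 - 4 / (2 * K + 2) := by
      field_simp
      ring
    linarith
  have hm : (eLpNorm (complexDilatation A) ∞ (volume.restrict Ω)).toReal ≤ k := by
    rw [eLpNorm_exponent_top]
    exact ENNReal.toReal_le_of_le_ofReal (Real.sqrt_nonneg _) (eLpNormEssSup_le_of_ae_bound hbound)
  have h0 : 0 ≤ (eLpNorm (complexDilatation A) ∞ (volume.restrict Ω)).toReal :=
    ENNReal.toReal_nonneg
  rw [qcCoefficient, one_le_div (by linarith)]
  linarith

/-- The Jacobian in terms of the Wirtinger derivatives. -/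
lemma jacobian_eq (Ω : Set ℂ) (φ : ℂ → ℂ) (z : ℂ) :
    jacobian Ω φ z = ‖dz Ω φ z‖ ^ 2 - ‖dzbar Ω φ z‖ ^ 2 := by
  rw [jacobian, clm_det_eq, ← Complex.normSq_eq_norm_sq, ← Complex.normSq_eq_norm_sq, dz, dzbar,
    Complex.normSq_apply, Complex.normSq_apply]
  simp
  ring

/-- The conformal invariance of the form: if `L` has determinant `1` and satisfies the Beltrami
equation of `A` at `z`, then `L` transforms the Euclidean form into that of `A z`. -/
lemma gradForm_comp_eq {z : ℂ} (hs : (A z).IsSymm) (hd : (A z).det = 1)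
    (hT : 0 < A z 0 0 + A z 1 1) {L : ℂ →L[ℝ] ℂ} (hL : L.det = 1)
    (hB : 1 / 2 * (L 1 + Complex.I * L Complex.I) =
      complexDilatation A z * (1 / 2 * (L 1 - Complex.I * L Complex.I))) (p q : ℂ →L[ℝ] ℝ) :
    gradForm (A z) (p.comp L) (q.comp L) = gradForm 1 p q := by
  have h01 : A z 1 0 = A z 0 1 := hs.apply 0 1
  have hne : ((A z 0 0 + A z 1 1 + 2 : ℝ) : ℂ) ≠ 0 := by
    rw [Complex.ofReal_ne_zero]; linarith
  have hB' : ((A z 0 0 + A z 1 1 + 2 : ℝ) : ℂ) * (L 1 + Complex.I * L Complex.I) =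
      (((A z 1 1 - A z 0 0 : ℝ) : ℂ) - 2 * Complex.I * ((A z 0 1 : ℝ) : ℂ)) *
        (L 1 - Complex.I * L Complex.I) := by
    rw [complexDilatation, det_one_add _ hd] at hB
    field_simp at hB
    linear_combination hB
  rw [clm_det_eq] at hL
  rw [Matrix.det_fin_two, h01] at hd
  have hre := congrArg Complex.re hB'
  have him := congrArg Complex.im hB'
  simp at hre him
  simp only [gradForm_eq, ContinuousLinearMap.comp_apply, h01]
  rw [clm_apply_eq p (L 1), clm_apply_eq p (L Complex.I), clm_apply_eq q (L 1),
    clm_apply_eq q (L Complex.I)]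
  generalize A z 0 0 = x at *
  generalize A z 0 1 = y at *
  generalize A z 1 1 = w at *
  generalize (L 1).re = a at *
  generalize (L 1).im = c at *
  generalize (L Complex.I).re = b at *
  generalize (L Complex.I).im = d at *
  have hT2 : x + w + 2 ≠ 0 := by linarith
  -- Writing $L=(u,v)$, the Beltrami equation is the pair $v_y=(A\nabla u)_1$, $v_x=-(A\nabla u)_2$:
  -- the second component is the $A$-harmonic conjugate of the first. Then $\det L=1$ reads $\langle
  -- A\nabla u,\nabla u\rangle=1$, from which the remaining entries of $LAL^T=I$ follow.
  have hd' : d = x * a + y * b := by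
    apply mul_left_cancel₀ hT2
    linear_combination (-(x + 1) / 2) * hre - (y / 2) * him - (a + d) * hd
  have hc' : c = -(y * a + w * b) := by
    apply mul_left_cancel₀ hT2
    linear_combination ((w + 1) / 2) * him + (y / 2) * hre + (b - c) * hd
  have hq : x * a ^ 2 + 2 * y * a * b + w * b ^ 2 = 1 := by
    rw [← hL, hd', hc']; ring
  have hq2 : x * c ^ 2 + 2 * y * c * d + w * d ^ 2 = 1 := by
    rw [hd', hc']
    linear_combination (x * a ^ 2 + 2 * y * a * b + w * b ^ 2) * hd + hq
  have hq3 : (x * a + y * b) * c + (y * a + w * b) * d = 0 := by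
    rw [hd', hc']; ring
  simp
  linear_combination (p 1 * q 1) * hq + (p Complex.I * q Complex.I) * hq2 +
    (p 1 * q Complex.I + p Complex.I * q 1) * hq3

end Beltrami

theorem isFormPreserving_of_volumePreserving {A : ℂ → Matrix (Fin 2) (Fin 2) ℝ} {Ω Ω' : Set ℂ}
    (hA : MatrixClass A Ω) {φ : OpenPartialHomeomorph ℂ ℂ} (hφ : IsAQuasiconformal A Ω Ω' φ)
    (hJ : ∀ᵐ z ∂(volume.restrict Ω), |jacobian Ω φ z| = 1) :
    IsFormPreserving A (fun _ => 1) φ (weakFDeriv Ω φ) := by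
  obtain ⟨⟨K, hqc⟩, hB⟩ := hφ
  obtain rfl := hqc.source_eq
  obtain ⟨K', hK', he⟩ := hA.elliptic
  have hdet : ∀ᵐ z ∂(volume.restrict φ.source), (weakFDeriv φ.source φ z).det = 1 := by
    filter_upwards [hB, hJ, hA.symm, hA.det_eq_one, he] with z hz hJz hs hd hez
    obtain ⟨hT, -⟩ := trace_bounds hK' hez
    have hμ : ‖complexDilatation A z‖ ^ 2 ≤ 1 := by
      rw [normSq_complexDilatation hs hd hT]
      linarith [show 0 ≤ 4 / (A z 0 0 + A z 1 1 + 2) by positivity]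
    have h0 : 0 ≤ jacobian φ.source φ z := by
      rw [jacobian_eq, hz, norm_mul, mul_pow]
      nlinarith [sq_nonneg ‖dz φ.source φ z‖]
    rwa [abs_of_nonneg h0] at hJz
  refine ⟨⟨hqc.weaklyDiff.hasWeakFDerivOn, ⟨K.toNNReal, ?_⟩, hdet⟩, hA.elliptic,
    ⟨1, le_rfl, isElliptic_one _⟩, ?_⟩
  · have hK := hqc.one_le
    filter_upwards [hqc.distortion, hJ] with z hz hJz
    rw [hJz, mul_one] at hz
    rw [Real.coe_toNNReal K (by linarith)]
    -- The distortion bound is $\|D\varphi\|^2\le K$; since $K\ge1$, the cruder $\|D\varphi\|\le K$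
    -- follows without a square root.
    nlinarith [norm_nonneg (weakFDeriv φ.source φ z)]
  · filter_upwards [hB, hdet, hA.symm, hA.det_eq_one, he] with z hz hdz hs hd hez p q
    exact gradForm_comp_eq hs hd (trace_bounds hK' hez).1 hdz hz p q

end AQuasiconformal

end

theorem corollary3p3 (Ω : Set ℂ) (A : ℂ → Matrix (Fin 2) (Fin 2) ℝ) (β : ℝ)
    (hA : AQuasiconformal.MatrixClass A Ω)
    (hΩ : AQuasiconformal.IsVolumePreservingRegularDomain A β Ω) :
    AQuasiconformal.firstEigenvalue A Ω ≤
        AQuasiconformal.qcCoefficient A Ω *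
          AQuasiconformal.firstEigenvalue (fun _ => 1) AQuasiconformal.unitDisc ∧
      ∀ l lD : ℝ, IsLeast (AQuasiconformal.dirichletEigenvalues A Ω) l →
        IsLeast (AQuasiconformal.dirichletEigenvalues (fun _ => 1) AQuasiconformal.unitDisc) lD →
        l ≤ AQuasiconformal.qcCoefficient A Ω * lD := by
  open AQuasiconformal in
  obtain ⟨φ, hreg, hJ⟩ := hΩ
  have h := isFormPreserving_of_volumePreserving hA hreg.map hJ
  obtain ⟨⟨K, hqc⟩, -⟩ := hreg.map
  have h1 := h.firstEigenvalue_eq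
  have h2 := h.dirichletEigenvalues_eq
  rw [hqc.source_eq, hqc.target_eq] at h1 h2
  -- The eigenvalues on the two sides are already equal; what remains is to multiply a nonnegative
  -- number by a factor at least $1$.
  have hK := one_le_qcCoefficient hA
  refine ⟨?_, fun l lD hl hlD => ?_⟩
  · rw [h1]
    exact le_mul_of_one_le_left (firstEigenvalue_nonneg _ _) hK
  · rw [h2] at hl
    rw [hl.unique hlD]
    exact le_mul_of_one_le_left
      (dirichletEigenvalue_nonneg le_rfl (isElliptic_one _) hlD.1) hK
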